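/- Let $P$ be a finite $(3+1)$-free poset, i.e. there are no chain $a_1<a_2<a_3$ and element $b$ in $P$ with $b$ incomparable to every $a_i$. Let $G(P)$ be its incomparability graph (vertices: the elements of $P$; edges: the pairs of incomparable elements), and let $X_{G(P)}(x_1,\dots,x_k)=\sum_f \prod_{v\in P} x_{f(v)}$, the sum over all proper colorings $f\colon P\to\{1,\dots,k\}$ of $G(P)$. A *part listing* $L$ is a finite word in the letters $v_i$ (one vertex on level $i\ge 0$) and $b_{i,i+1}(H)$ ($H$ a bipartite graph with $r$ lower vertices, placed on level $i$, and $s$ upper vertices, placed on level $i+1$). Its poset has the vertices of the parts as elements, and $x<y$ iff (i) the level of $y$ exceeds that of $x$ by at least $2$, or (ii) $x$ is one level below $y$ and the part containing $x$ appears before the part containing $y$, or (iii) $x$ is one level below $y$ and they are joined by an edge of a bicolored part $H$. *Greedy weight.* For a bicolored part $b_{i,i+1}(H)$ let $q_j$ be the probability that a uniformly random matching with $\min(r,s)$ edges between the lower and the upper vertices has exactly $j$ edges in common with $H$, and let $j$ be the largest index with $q_j\neq 0$. Replace $b_{i,i+1}(H)$ by the word $v_{i+1}^{s-j}v_i^{r}v_{i+1}^{j}$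 if $r\ge s$, and by $v_i^{j}v_{i+1}^{s}v_i^{r-j}$ if $r<s$. Doing this for every bicolored part of $L$ gives a part listing $L'$. Choose $h\colon\{1,\dots,n\}\to\{1,\dots,n\}$ weakly increasing with $h(i)\ge i$ for all $i$ (the Hessenberg function of a Dyck path), such that the incomparability graph of the poset of $L'$ is isomorphic to the indifference graph of $h$, i.e. the graph on $\{1,\dots,n\}$ in which $i<j$ are adjacent iff $j\le h(i)$. Color this indifference graph greedily: treat the vertices in the order $1,\dots,n$ and give each the smallest color not used on its earlier neighbors. The greedy weight is the vector of sizes of the color classes $1,2,\dots$. **Theorem.** There are part listings whose poset is isomorphic to $P$; for each of them such an $h$ exists, and the greedy weight is a partition that depends neither on the part listing nor on $h$. Call it $\lambda=\lambda^{\mathrm{gr}}(P)$, and let $\ell$ be its length. Then for every $k\ge 0$: 1. $X_{G(P)}(x_1,\dots,x_k)$ is SNP, i.e. the set of exponent vectors of its monomials is the set of all lattice points of its Newton polytope (the convex hull of these exponent vectors in $\mathbb R^k$); 2. this Newton polytope is the permutahedron $\mathcal P^{(k)}_{\lambda}$, which is the convex hull of the permutations of $(\lambda_1,\dots,\lambda_\ell,0,\dots,0)$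 in $\mathbb R^k$ if $k\ge \ell$, and the empty set if $k<\ell$; 3. $\lambda$ dominates the weight $\alpha=(|f^{-1}(1)|,\dots,|f^{-1}(k)|)$ of every proper coloring $f\colon P\to\{1,\dots,k\}$ of $G(P)$: $|\alpha|=|\lambda|$ and $\alpha_1+\dots+\alpha_m\le\lambda_1+\dots+\lambda_m$ for all $m$ (with $\alpha_i=0$ for $i>k$ and $\lambda_i=0$ for $i>\ell$). -/

import Mathlib

/-! ### Posets and incomparability graphs -/

/-- A poset is `(m+n)`-free if there are no chains `a₁ < ⋯ < aₘ` and `b₁ < ⋯ < bₙ` such that every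
`aᵢ` is incomparable to every `bⱼ` (such chains are automatically disjoint). -/
def ChainSumFree (P : Type*) [PartialOrder P] (m n : ℕ) : Prop :=
  ¬ ∃ (a : Fin m → P) (b : Fin n → P), StrictMono a ∧ StrictMono b ∧
    ∀ i j, IncompRel (· ≤ ·) (a i) (b j)

/-- The incomparability graph `G(P)` of a poset `P`. -/
def incompGraph (P : Type*) [PartialOrder P] : SimpleGraph P where
  Adj x y := IncompRel (· ≤ ·) x y
  symm := ⟨fun _ _ h => h.symm⟩
  loopless := ⟨fun _ h => h.1 le_rfl⟩

/-! ### Chromatic symmetric polynomials, Newton polytopes, permutahedra -/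

/-- The chromatic symmetric function of `G` in `k` variables,
`∑ ∏_v x_{f(v)}` over the proper colorings `f : V(G) → [k]`. -/
noncomputable def chromaticSymm {V : Type*} [Fintype V] (G : SimpleGraph V) (k : ℕ) :
    MvPolynomial (Fin k) ℝ :=
  ∑ f : G.Coloring (Fin k), ∏ v : V, MvPolynomial.X (f v)

/-- The weight of a coloring: the sizes of its color classes. -/
noncomputable def colorWeight {V : Type*} {G : SimpleGraph V} {k : ℕ} (f : G.Coloring (Fin k))
    (i : Fin k) : ℕ :=
  Nat.card {v : V // f v = i}

/-- The exponent vectors of the monomials of `p`, as points of `ℝᵏ`. -/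
def supportPoints {k : ℕ} (p : MvPolynomial (Fin k) ℝ) : Set (Fin k → ℝ) :=
  {x | ∃ m ∈ p.support, ∀ i, x i = (m i : ℝ)}

/-- The Newton polytope of `p`. -/
def newtonPolytope {k : ℕ} (p : MvPolynomial (Fin k) ℝ) : Set (Fin k → ℝ) :=
  convexHull ℝ (supportPoints p)

/-- `p` has saturated Newton polytope: its support is the set of all lattice points of its
Newton polytope. -/
def IsSNP {k : ℕ} (p : MvPolynomial (Fin k) ℝ) : Prop :=
  supportPoints p = newtonPolytope p ∩ {x | ∃ z : Fin k → ℤ, ∀ i, x i = (z i : ℝ)}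

/-- A partition, written as the list of its (positive) parts in weakly decreasing order. -/
def IsPartition (lam : List ℕ) : Prop :=
  lam.SortedGE ∧ ∀ a ∈ lam, 0 < a

/-- The permutahedron `P_λ^{(k)}` of a partition `λ` of length `ℓ`: for `ℓ ≤ k`, the convex hull of
the permutations of `(λ₁, …, λ_ℓ, 0, …, 0)` in `ℝᵏ`; for `k < ℓ`, the empty set. -/
def permutahedron (lam : List ℕ) (k : ℕ) : Set (Fin k → ℝ) :=
  if lam.length ≤ k then
    convexHull ℝ {x | ∃ σ : Equiv.Perm (Fin k), ∀ i, x i = (lam.getD (σ i) 0 : ℝ)}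
  else ∅

/-- `λ` dominates the composition `α`: both have the same size, and each partial sum of `α` is at
most the corresponding partial sum of `λ`. -/
def Dominates {k : ℕ} (lam : List ℕ) (α : Fin k → ℕ) : Prop :=
  ∑ i, α i = lam.sum ∧ ∀ m : ℕ, ∑ i with i.val < m, α i ≤ (lam.take m).sum

/-! ### Indifference graphs and greedy colorings -/

/-- The Hessenberg function of a Dyck path of length `n`: the number of squares below the path
in each column. With columns and rows numbered from `0`, `toFun i` is the topmost row below the
path in column `i`. -/
structure HessenbergFun (n : ℕ) where
  toFun : Fin n → Fin n
  le_toFun : ∀ i, i ≤ toFun i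
  mono : Monotone toFun

/-- The indifference graph `G(d)` of the Dyck path `d` with Hessenberg function `h`:
for `i < j` there is an edge `ij` iff `j ≤ h(i)`. -/
def HessenbergFun.graph {n : ℕ} (h : HessenbergFun n) : SimpleGraph (Fin n) where
  Adj i j := (i < j ∧ j ≤ h.toFun i) ∨ (j < i ∧ i ≤ h.toFun j)
  symm := ⟨fun _ _ H => H.symm⟩
  loopless := ⟨fun _ H => H.elim (fun H => lt_irrefl _ H.1) (fun H => lt_irrefl _ H.1)⟩

/-- The greedy coloring of a graph on `{0, …, n-1}`: the vertices are colored in increasing order,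
each with the smallest color `0, 1, 2, …` not used on its neighbors colored before. -/
noncomputable def greedyColor {n : ℕ} (G : SimpleGraph (Fin n)) (v : Fin n) : ℕ :=
  sInf {c : ℕ | ∀ u : {u : Fin n // u < v}, G.Adj u.1 v → greedyColor G u.1 ≠ c}
termination_by v.val
decreasing_by exact u.2

/-- The weight of the greedy coloring: the sizes of its color classes `0, 1, 2, …`, up to the
largest color used. -/
noncomputable def greedyWeight {n : ℕ} (G : SimpleGraph (Fin n)) : List ℕ :=
  (List.range (Finset.univ.sup fun v => greedyColor G v + 1)).map
    fun c => Nat.card {v : Fin n // greedyColor G v = c}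

/-! ### ListingPart listings -/

/-- A part: a vertex `v_i` on level `i`, or a bicolored graph `b_{i,i+1}(H)` with `r` lower vertices
on level `i`, `s` upper vertices on level `i + 1`, and edge set `H`. -/
inductive ListingPart where
  | vertex (i : ℕ)
  | bicolored (i r s : ℕ) (H : Finset (Fin r × Fin s))

/-- The vertices of a part. -/
def ListingPart.Vert : ListingPart → Type
  | .vertex _ => Unit
  | .bicolored _ r s _ => Fin r ⊕ Fin s

/-- The level of a vertex of a part. -/
def ListingPart.level : (p : ListingPart) → p.Vert → ℕ
  | .vertex i, _ => i
  | .bicolored i _ _ _, .inl _ => i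
  | .bicolored i _ _ _, .inr _ => i + 1

/-- `p.Joined x y`: `p` is a bicolored graph, and `x` (lower) and `y` (upper) are joined in it. -/
def ListingPart.Joined : (p : ListingPart) → p.Vert → p.Vert → Prop
  | .bicolored _ _ _ H, .inl a, .inr b => (a, b) ∈ H
  | _, _, _ => False

/-- The vertices of a part listing (an ordered list of parts). -/
def PartListingPoset (L : List ListingPart) : Type :=
  Σ p : Fin L.length, (L.get p).Vert

namespace PartListingPoset

variable {L : List ListingPart}

/-- The level of a vertex of a part listing. -/
def level (x : PartListingPoset L) : ℕ := (L.get x.1).level x.2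

/-- The strict order of the poset of a part listing. -/
def Below (x y : PartListingPoset L) : Prop :=
  level x + 2 ≤ level y ∨
  (level x + 1 = level y ∧ x.1 < y.1) ∨
  ∃ (p : Fin L.length) (a b : (L.get p).Vert), x = ⟨p, a⟩ ∧ y = ⟨p, b⟩ ∧ (L.get p).Joined a b

theorem _root_.ListingPart.Joined.level_eq {p : ListingPart} {a b : p.Vert} (h : p.Joined a b) :
    p.level b = p.level a + 1 := by
  match p, a, b, h with
  | .bicolored _ _ _ _, .inl _, .inr _, _ => rfl

theorem Below.level_lt {x y : PartListingPoset L} (h : Below x y) : level x + 1 ≤ level y := by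
  rcases h with h | ⟨h, _⟩ | ⟨p, a, b, rfl, rfl, h⟩
  · omega
  · exact h.le
  · exact h.level_eq.ge

/-- The poset of a part listing. -/
instance : PartialOrder (PartListingPoset L) where
  le x y := x = y ∨ Below x y
  lt x y := Below x y
  le_refl x := Or.inl rfl
  le_trans x y z := by
    rintro (rfl | h) (rfl | h')
    · exact Or.inl rfl
    · exact Or.inr h'
    · exact Or.inr h
    · have := h.level_lt
      have := h'.level_lt
      exact Or.inr (Or.inl (by omega))
  le_antisymm x y := by
    rintro (rfl | h) (h' | h')
    · rfl
    · rfl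
    · exact h'.symm
    · have := h.level_lt
      have := h'.level_lt
      omega
  lt_iff_le_not_ge x y := by
    constructor
    · intro h
      refine ⟨Or.inr h, ?_⟩
      have := h.level_lt
      rintro (rfl | h')
      · omega
      · have := h'.level_lt
        omega
    · rintro ⟨rfl | h, h'⟩
      · exact absurd (Or.inl rfl) h'
      · exact h

end PartListingPoset

/-! ### The greedy weight of a part listing -/

/-- The matchings with `min r s` edges between the `r` lower and the `s` upper vertices. -/
def maxMatchings (r s : ℕ) : Finset (Finset (Fin r × Fin s)) :=
  {M | M.card = min r s ∧ ∀ e ∈ M, ∀ e' ∈ M, e.1 = e'.1 ∨ e.2 = e'.2 → e = e'}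

/-- The probability `q_j` that a uniformly random matching with `min r s` edges between the lower
and the upper vertices has exactly `j` edges in common with `H`. -/
def matchProb {r s : ℕ} (H : Finset (Fin r × Fin s)) (j : ℕ) : ℚ :=
  ({M ∈ maxMatchings r s | (H ∩ M).card = j}.card : ℚ) / ((maxMatchings r s).card : ℚ)

/-- The largest `j` with `q_j ≠ 0`. -/
def topMatch {r s : ℕ} (H : Finset (Fin r × Fin s)) : ℕ :=
  Nat.findGreatest (fun j => matchProb H j ≠ 0) (min r s)

/-- `U_j = v_{i+1}^{s-j} v_i^r v_{i+1}^j`, used for `j ≤ s`. -/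
def listU (i r s j : ℕ) : List ListingPart :=
  List.replicate (s - j) (.vertex (i + 1)) ++ List.replicate r (.vertex i) ++
    List.replicate j (.vertex (i + 1))

/-- `D_j = v_i^j v_{i+1}^s v_i^{r-j}`, used for `j ≤ r`. -/
def listD (i r s j : ℕ) : List ListingPart :=
  List.replicate j (.vertex i) ++ List.replicate s (.vertex (i + 1)) ++
    List.replicate (r - j) (.vertex i)

/-- A bicolored part is replaced by `U_j` if `r ≥ s`, and by `D_j` if `r < s`, where `j` is the
largest index with `q_j ≠ 0`. -/
def ListingPart.reduce : ListingPart → List ListingPart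
  | .vertex i => [.vertex i]
  | .bicolored i r s H =>
      if s ≤ r then listU i r s (topMatch H) else listD i r s (topMatch H)

/-- The part listing obtained from `L` by replacing every bicolored part; it has only single
vertices as parts. -/
def reduceListing (L : List ListingPart) : List ListingPart := L.flatMap ListingPart.reduce

/-- `lam` is the greedy weight computed from the part listing `L`: the incomparability graph of the
poset of the reduced listing is (isomorphic to) the indifference graph of a Dyck path,
and `lam` is the weight of the greedy coloring of that indifference graph. -/
def IsGreedyWeight (L : List ListingPart) (lam : List ℕ) : Prop :=
  ∃ (n : ℕ) (h : HessenbergFun n),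
    Nonempty (incompGraph (PartListingPoset (reduceListing L)) ≃g h.graph) ∧
      lam = greedyWeight h.graph

/-! The weights of the proper colorings of `G(P)` form a family of compositions with three properties,
and everything else is a formal consequence of them.

* It is closed under moving one unit from an entry to an entry smaller by at least `2`
  (`ChainSumFree.colorWeights_transfer`). Color classes are chains; two chains whose lengths differ by
  at least `2` can be cut in such a way that exchanging the tails moves one unit, since a failing cut
  can be advanced by one step: this is where an element and a chain of three elements meet, and the
  `(3+1)`-free condition is used.
* It does not change when the bicolored parts of a part listing are replaced
  (`colorWeights_reduceListing`). A color class meets a bicolored part in one vertex or in an edge,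
  and its other elements see only the levels of these vertices. So the possible sets of pairs
  (level, color) depend only on the numbers of vertices of the parts on each level and on the
  matching numbers of the bicolored parts, and these agree for `H` and its replacement, `topMatch H`
  being the matching number of `H`.
* After the replacement, the poset is a unit interval order
  (`exists_iso_hessenbergFun_graph_of_vertices`), and the greedy coloring of an indifference graph has
  the greatest weight of all proper colorings (`isGreatestWeight_greedyWeight`): the earlier neighbors
  of a vertex form a clique, so a vertex receives a color `≥ m` only if all colors `< m` occur among
  them, while any proper coloring uses each of the colors `< m` at most once on this clique.

Hence the greedy weight of any part listing of `P` is the greatest weight of the proper colorings of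
`G(P)` in dominance order, which makes it unique and a partition. A set of compositions closed under
permutations and unit transfers contains everything dominated by one of its elements
(`mem_of_partialSum_perm_le`). Applied to the weights and to the permutahedron, this shows that the
weights are exactly the lattice points of the permutahedron (`isSNP_and_newtonPolytope_eq`).

A part listing of `P` exists (`ChainSumFree.exists_listing`) by the following argument. The rank
serves as level; elements whose ranks differ by at least `2` are comparable. On adjacent levels, the
order forces `x` not to come later than `y` if `x < y` with `x` below, or if `x` is above `y` and
incomparable to it. By the `(3+1)`-free condition, the strongly connected components of this relation
span at most two levels (`ChainSumFree.lev_le_of_reflTransGen`). The components, put in a linear order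
compatible with the relation, are the parts. -/

/-! ### Unit transfers and dominance -/

/-- The sum of the entries of `a` with index less than `m`. -/
def partialSum {k : ℕ} (a : Fin k → ℕ) (m : ℕ) : ℕ := ∑ i with i.val < m, a i

theorem partialSum_succ {k : ℕ} (a : Fin k → ℕ) (i : Fin k) :
    partialSum a (i.val + 1) = partialSum a i.val + a i := by
  have : (Finset.univ.filter fun l : Fin k => l.val < i.val + 1) =
      insert i (Finset.univ.filter fun l : Fin k => l.val < i.val) := by
    ext l
    simp [Fin.ext_iff]
    omega
  rw [partialSum, this, Finset.sum_insert (by simp), add_comm, partialSum]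

theorem partialSum_zero {k : ℕ} (a : Fin k → ℕ) : partialSum a 0 = 0 := by
  simp [partialSum]

theorem partialSum_of_le {k : ℕ} (a : Fin k → ℕ) {m : ℕ} (hm : k ≤ m) :
    partialSum a m = ∑ i, a i := by
  rw [partialSum, Finset.filter_true_of_mem]
  intro i _
  omega

/-- `IsTransfer a a' i j`: `a'` arises from `a` by moving one unit from entry `i` to entry `j`,
where `a i` exceeds `a j` by at least `2`. -/
structure IsTransfer {k : ℕ} (a a' : Fin k → ℕ) (i j : Fin k) : Prop where
  two_le : a j + 2 ≤ a i
  source : a' i + 1 = a i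
  target : a' j = a j + 1
  other : ∀ l, l ≠ i → l ≠ j → a' l = a l

theorem IsTransfer.ne {k : ℕ} {a a' : Fin k → ℕ} {i j : Fin k} (h : IsTransfer a a' i j) :
    i ≠ j := by
  rintro rfl
  have := h.two_le
  omega

theorem IsTransfer.sum_eq {k : ℕ} {a a' : Fin k → ℕ} {i j : Fin k} (h : IsTransfer a a' i j)
    (T : Finset (Fin k)) :
    ∑ l ∈ T, a' l + (if i ∈ T then 1 else 0) = ∑ l ∈ T, a l + (if j ∈ T then 1 else 0) := by
  have hij := h.ne
  have h1 : ∀ l, a' l + (if l = i then 1 else 0) = a l + (if l = j then 1 else 0) := by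
    intro l
    by_cases hi : l = i
    · subst hi
      simp [hij, h.source]
    · by_cases hj : l = j
      · subst hj
        simp [hi, h.target]
      · simp [hi, hj, h.other l hi hj]
  have := Finset.sum_congr (rfl : T = T) fun l _ => h1 l
  simpa [Finset.sum_add_distrib] using this

/-- A set of compositions that is closed under unit transfers contains, together with `a`, every
weakly decreasing composition `b` dominated by `a`. If `a ≠ b`, a unit is moved from the first entry
`i` with `a i ≠ b i` to the last entry `j` before the partial sums agree again: then
`a i > b i ≥ b j > a j`, and the partial sums of `a`, which decrease between `i` and `j` only, still
bound those of `b`. -/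
theorem mem_of_partialSum_le {k : ℕ} {S : Set (Fin k → ℕ)}
    (hS : ∀ a ∈ S, ∀ a' i j, IsTransfer a a' i j → a' ∈ S) {b : Fin k → ℕ} (hb : Antitone b)
    {a : Fin k → ℕ} (ha : a ∈ S) (hsum : ∑ i, a i = ∑ i, b i)
    (hle : ∀ m, partialSum b m ≤ partialSum a m) : b ∈ S := by
  induction hD : ∑ m ∈ Finset.range (k + 1), (partialSum a m - partialSum b m) using
    Nat.strong_induction_on generalizing a with
  | _ D ih =>
  by_cases hab : a = b
  · exact hab ▸ ha
  -- The first entry `i` in which `a` and `b` differ.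
  have hex : ∃ m, ∃ hm : m < k, a ⟨m, hm⟩ ≠ b ⟨m, hm⟩ := by
    by_contra! hcon
    exact hab (funext fun l => hcon l.val l.isLt)
  classical
  obtain ⟨hik, hi⟩ := Nat.find_spec hex
  set i : Fin k := ⟨Nat.find hex, hik⟩ with hidef
  have heq : ∀ m, m ≤ i.val → partialSum a m = partialSum b m := by
    intro m hm
    induction m with
    | zero => simp [partialSum_zero]
    | succ m ihm =>
      have hmk : m < k := by omega
      have h1 := partialSum_succ a ⟨m, hmk⟩
      have h2 := partialSum_succ b ⟨m, hmk⟩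
      have h3 := Nat.find_min hex (m := m) hm
      push Not at h3
      have h3 := h3 hmk
      have := ihm (by omega)
      simp only at h1 h2
      omega
  have hgt : b i < a i := by
    have h1 := partialSum_succ a i
    have h2 := partialSum_succ b i
    have h3 := heq i.val le_rfl
    have := hle (i.val + 1)
    omega
  -- The first place after `i` where the partial sums agree again; `j` is the entry before it.
  have hex2 : ∃ m, i.val < m ∧ partialSum a m = partialSum b m :=
    ⟨k, i.isLt, by rw [partialSum_of_le _ le_rfl, partialSum_of_le _ le_rfl, hsum]⟩
  obtain ⟨hJ1, hJ2⟩ := Nat.find_spec hex2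
  have hJ3 : ∀ m, i.val < m → m < Nat.find hex2 → partialSum b m < partialSum a m := by
    intro m h1 h2
    have := Nat.find_min hex2 h2
    have h3 := hle m
    by_contra hcon
    exact this ⟨h1, by omega⟩
  have hJk : Nat.find hex2 ≤ k := Nat.find_min' hex2
    ⟨i.isLt, by rw [partialSum_of_le _ le_rfl, partialSum_of_le _ le_rfl, hsum]⟩
  have hJi : i.val + 1 < Nat.find hex2 := by
    have h1 := partialSum_succ a i
    have h2 := partialSum_succ b i
    have h3 := heq i.val le_rfl
    rcases Nat.lt_or_ge (i.val + 1) (Nat.find hex2) with h | h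
    · exact h
    · have h4 : Nat.find hex2 = i.val + 1 := by omega
      rw [h4] at hJ2
      omega
  generalize hJ : Nat.find hex2 = J at *
  obtain ⟨j', rfl⟩ : ∃ j', J = j' + 1 := ⟨J - 1, by omega⟩
  set j : Fin k := ⟨j', by omega⟩ with hjdef
  have hlt : a j < b j := by
    have h1 := partialSum_succ a j
    have h2 := partialSum_succ b j
    have h3 := hJ3 j' (by omega) (by omega)
    simp only [hjdef] at h1 h2 ⊢
    omega
  have hbij : b j ≤ b i := hb (by rw [Fin.le_def]; simp only [hjdef]; omega)
  have hij : i ≠ j := by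
    intro h
    rw [h] at hgt
    omega
  set a' : Fin k → ℕ := Function.update (Function.update a i (a i - 1)) j (a j + 1) with ha'
  have htr : IsTransfer a a' i j := by
    refine ⟨by omega, ?_, by simp [ha'], ?_⟩
    · simp [ha', hij]
      omega
    · intro l h1 h2
      simp [ha', h1, h2]
  have hps : ∀ m, partialSum a' m + (if i.val < m then 1 else 0) =
      partialSum a m + (if j.val < m then 1 else 0) := by
    intro m
    have := htr.sum_eq (Finset.univ.filter fun l : Fin k => l.val < m)
    simpa [partialSum] using this
  have hj' : j.val = j' := rfl
  have hle' : ∀ m, partialSum b m ≤ partialSum a' m ∧ partialSum a' m ≤ partialSum a m := by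
    intro m
    have h1 := hps m
    have h2 := hle m
    have h3 := hJ3 m
    split_ifs at h1 <;> omega
  refine ih _ ?_ (hS a ha a' i j htr) ?_ (fun m => (hle' m).1) rfl
  · rw [← hD]
    refine Finset.sum_lt_sum (fun m _ => ?_) ⟨i.val + 1, by simp, ?_⟩
    · have := hle' m
      omega
    · have h1 := hps (i.val + 1)
      have h2 := hJ3 (i.val + 1) (by omega) (by omega)
      have h3 := (hle' (i.val + 1)).1
      split_ifs at h1 <;> omega
  · have := htr.sum_eq Finset.univ
    simp at this
    omega

/-! ### The greedy coloring of an indifference graph -/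

theorem List.sum_take_add_one (l : List ℕ) (m : ℕ) :
    (l.take (m + 1)).sum = (l.take m).sum + l.getD m 0 := by
  by_cases hm : m < l.length
  · rw [List.take_add_one, List.sum_append, List.getD_eq_getElem _ _ hm]
    simp [hm]
  · rw [List.getD_eq_default _ _ (not_lt.mp hm), List.take_of_length_le (by omega),
      List.take_of_length_le (by omega), add_zero]

section Greedy

variable {n : ℕ} {G : SimpleGraph (Fin n)}

theorem greedyColor_ne {u v : Fin n} (huv : u < v) (h : G.Adj u v) :
    greedyColor G u ≠ greedyColor G v := by
  have hne : {c : ℕ | ∀ u : {u : Fin n // u < v}, G.Adj u.1 v → greedyColor G u.1 ≠ c}.Nonempty := by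
    obtain ⟨c, hc⟩ := Infinite.exists_notMem_finset (Finset.univ.image (greedyColor G))
    refine ⟨c, fun u _ hu => hc ?_⟩
    simp only [Finset.mem_image, Finset.mem_univ, true_and]
    exact ⟨u.1, hu⟩
  have := Nat.sInf_mem hne
  rw [← greedyColor.eq_1] at this
  exact this ⟨u, huv⟩ h

theorem exists_adj_of_lt_greedyColor {v : Fin n} {c : ℕ} (hc : c < greedyColor G v) :
    ∃ u < v, G.Adj u v ∧ greedyColor G u = c := by
  rw [greedyColor.eq_1] at hc
  have := Nat.notMem_of_lt_sInf hc
  simp only [Set.mem_ofPred_eq, not_forall, not_not] at this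
  obtain ⟨⟨u, hu⟩, h1, h2⟩ := this
  exact ⟨u, hu, h1, h2⟩

theorem greedyColor_ne_of_adj {u v : Fin n} (h : G.Adj u v) :
    greedyColor G u ≠ greedyColor G v := by
  rcases lt_trichotomy u v with huv | rfl | huv
  · exact greedyColor_ne huv h
  · exact (G.loopless.irrefl _ h).elim
  · exact (greedyColor_ne huv h.symm).symm

theorem length_greedyWeight : (greedyWeight G).length =
    Finset.univ.sup fun v => greedyColor G v + 1 := by
  simp [greedyWeight]

theorem greedyColor_lt_length (v : Fin n) : greedyColor G v < (greedyWeight G).length := by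
  rw [length_greedyWeight]
  exact Finset.le_sup (f := fun v => greedyColor G v + 1) (Finset.mem_univ v)

theorem greedyWeight_getD (c : ℕ) :
    (greedyWeight G).getD c 0 = Nat.card {v : Fin n // greedyColor G v = c} := by
  by_cases hc : c < (greedyWeight G).length
  · rw [List.getD_eq_getElem _ _ hc]
    simp [greedyWeight]
  · rw [List.getD_eq_default _ _ (not_lt.mp hc)]
    have : IsEmpty {v : Fin n // greedyColor G v = c} :=
      ⟨fun v => hc (v.2 ▸ greedyColor_lt_length v.1)⟩
    simp

theorem greedyWeight_pos : ∀ a ∈ greedyWeight G, 0 < a := by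
  intro a ha
  obtain ⟨c, hc, rfl⟩ := List.mem_iff_getElem.mp ha
  have h2 := greedyWeight_getD (G := G) c
  rw [List.getD_eq_getElem _ _ hc] at h2
  rw [h2]
  rw [length_greedyWeight, Finset.lt_sup_iff] at hc
  obtain ⟨v, -, hv⟩ := hc
  have : Nonempty {v : Fin n // greedyColor G v = c} := by
    rcases (Nat.lt_succ_iff.mp hv).lt_or_eq with h | h
    · obtain ⟨u, -, -, hu⟩ := exists_adj_of_lt_greedyColor h
      exact ⟨u, hu⟩
    · exact ⟨v, h.symm⟩
  exact Nat.card_pos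

theorem sum_take_greedyWeight (m : ℕ) :
    ((greedyWeight G).take m).sum = (Finset.univ.filter fun v => greedyColor G v < m).card := by
  induction m with
  | zero => simp
  | succ m ih =>
    rw [List.sum_take_add_one, ih, greedyWeight_getD, Nat.card_eq_fintype_card, Fintype.card_subtype,
      ← Finset.card_union_of_disjoint]
    · congr 1
      ext v
      simp
      omega
    · rw [Finset.disjoint_left]
      intro v
      simp
      omega

theorem sum_greedyWeight : (greedyWeight G).sum = n := by
  have := sum_take_greedyWeight (G := G) (greedyWeight G).length
  rw [List.take_length] at this
  rw [this, Finset.filter_true_of_mem fun v _ => greedyColor_lt_length v]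
  simp

end Greedy

/-- In an indifference graph, everything between a vertex and one of its neighbors forms a clique
with the two. -/
theorem HessenbergFun.adj_of_between {n : ℕ} (h : HessenbergFun n) {u v w w' : Fin n}
    (huv : u < v) (hadj : h.graph.Adj u v) (huw : u ≤ w) (hww' : w < w') (hw'v : w' ≤ v) :
    h.graph.Adj w w' := by
  have : v ≤ h.toFun u := by
    rcases hadj with hadj | hadj
    · exact hadj.2
    · exact absurd hadj.1 (not_lt.mpr huv.le)
  exact Or.inl ⟨hww', hw'v.trans (this.trans (h.mono huw))⟩

/-- On every initial segment, the greedy coloring of an indifference graph gives at least as many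
vertices one of the colors below `m` as any other proper coloring. -/
theorem card_color_lt_le_prefix {n k : ℕ} (h : HessenbergFun n) (f : h.graph.Coloring (Fin k))
    (m t : ℕ) :
    (Finset.univ.filter fun v : Fin n => v.val < t ∧ (f v).val < m).card ≤
      (Finset.univ.filter fun v : Fin n => v.val < t ∧ greedyColor h.graph v < m).card := by
  induction t using Nat.strong_induction_on with
  | _ t ih =>
  rcases t with _ | t
  · simp
  by_cases htn : t < n
  swap
  · have h1 : ∀ v : Fin n, v.val < t + 1 ↔ v.val < t := fun v => by omega
    simpa only [h1] using ih t (by omega)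
  set v : Fin n := ⟨t, htn⟩ with hv
  have hsplit : ∀ (p : Fin n → Prop) [DecidablePred p] (a : ℕ), a ≤ t + 1 →
      (Finset.univ.filter fun w : Fin n => w.val < t + 1 ∧ p w).card =
      (Finset.univ.filter fun w : Fin n => w.val < a ∧ p w).card +
      (Finset.univ.filter fun w : Fin n => (a ≤ w.val ∧ w.val < t + 1) ∧ p w).card := by
    intro p _ a ha
    rw [← Finset.card_union_of_disjoint]
    · congr 1
      ext w
      simp only [Finset.mem_filter, Finset.mem_univ, true_and, Finset.mem_union]
      by_cases p w <;> simp [*]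
      omega
    · rw [Finset.disjoint_left]
      intro w
      simp
      omega
  by_cases hg : greedyColor h.graph v < m ∨ ¬ (f v).val < m
  · rw [hsplit _ t (by omega), hsplit _ t (by omega)]
    refine add_le_add (ih t (by omega)) (Finset.card_le_card ?_)
    intro w
    simp only [Finset.mem_filter, Finset.mem_univ, true_and]
    rintro ⟨hw, hw2⟩
    have : w = v := Fin.ext (by simp [hv]; omega)
    subst this
    exact ⟨hw, hg.resolve_right (not_not.mpr hw2)⟩
  · push Not at hg
    obtain ⟨hg1, hg2⟩ := hg
    classical
    -- `a` is the first neighbor of `v`; the colors below `m` all occur from `a` on.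
    obtain ⟨u0, hu0, hu0v, -⟩ := exists_adj_of_lt_greedyColor (c := 0)
      (show 0 < greedyColor h.graph v by omega)
    obtain ⟨a, ha⟩ := Finset.exists_min_image
      (Finset.univ.filter fun u : Fin n => u < v ∧ h.graph.Adj u v) id
      ⟨u0, by simp [hu0, hu0v]⟩
    simp only [Finset.mem_filter, Finset.mem_univ, true_and, id] at ha
    obtain ⟨⟨hav, hadj⟩, hmin⟩ := ha
    have hat : a.val < t := hav
    rw [hsplit _ a.val (by omega), hsplit _ a.val (by omega)]
    refine add_le_add (ih a.val (by omega)) ?_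
    calc _ ≤ (Finset.range m).card := by
          refine Finset.card_le_card_of_injOn (fun w => (f w).val) ?_ ?_
          · intro w
            simp
          · intro w hw w' hw' heq
            simp only [Finset.coe_filter, Finset.mem_univ, true_and, Set.mem_ofPred_eq] at hw hw'
            have heq' : f w = f w' := Fin.ext heq
            by_contra hne
            rcases lt_or_gt_of_ne hne with hlt | hlt
            · refine f.valid (h.adj_of_between hav hadj ?_ hlt ?_) heq'
              · exact hw.1.1
              · exact Nat.lt_succ_iff.mp hw'.1.2
            · refine f.valid (h.adj_of_between hav hadj ?_ hlt ?_) heq'.symm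
              · exact hw'.1.1
              · exact Nat.lt_succ_iff.mp hw.1.2
      _ ≤ _ := by
          refine (Finset.card_le_card ?_).trans (Finset.card_image_le (f := greedyColor h.graph))
          intro c hc
          rw [Finset.mem_range] at hc
          obtain ⟨u, huv, hadju, hcu⟩ := exists_adj_of_lt_greedyColor (hc.trans_le hg1)
          have h1 := hmin u ⟨huv, hadju⟩
          simp only [Finset.mem_image, Finset.mem_filter, Finset.mem_univ, true_and]
          exact ⟨u, ⟨⟨h1, Nat.lt_succ_of_lt huv⟩, by omega⟩, hcu⟩

/-- The greedy weight of an indifference graph dominates the weight of every proper coloring. -/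
theorem dominates_greedyWeight {n k : ℕ} (h : HessenbergFun n) (f : h.graph.Coloring (Fin k)) :
    Dominates (greedyWeight h.graph) (colorWeight f) := by
  have hw : ∀ i, colorWeight f i = (Finset.univ.filter fun v => f v = i).card := by
    intro i
    rw [colorWeight, Nat.card_eq_fintype_card, Fintype.card_subtype]
  constructor
  · rw [sum_greedyWeight]
    simp only [hw]
    have := Finset.card_eq_sum_card_fiberwise (s := (Finset.univ : Finset (Fin n)))
      (t := Finset.univ) (f := f) (fun _ _ => by simp)
    rw [← this]
    simp
  · intro m
    have h1 := card_color_lt_le_prefix h f m n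
    simp only [Fin.is_lt, true_and] at h1
    rw [sum_take_greedyWeight]
    refine le_trans (le_of_eq ?_) h1
    simp only [hw]
    have := Finset.card_eq_sum_card_fiberwise
      (s := Finset.univ.filter fun v : Fin n => (f v).val < m)
      (t := Finset.univ.filter fun i : Fin k => i.val < m) (f := f) (fun v hv => by simpa using hv)
    rw [this]
    refine Finset.sum_congr rfl fun i hi => ?_
    congr 1
    ext v
    simp only [Finset.mem_filter, Finset.mem_univ, true_and] at hi ⊢
    exact ⟨fun hv => ⟨hv ▸ hi, hv⟩, fun hv => hv.2⟩

/-! ### Moving one unit between two color classes -/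

/-- The weights of the proper colorings of `G` with `k` colors. -/
def colorWeights {V : Type*} (G : SimpleGraph V) (k : ℕ) : Set (Fin k → ℕ) :=
  {α | ∃ f : G.Coloring (Fin k), colorWeight f = α}

theorem colorWeights_congr {V W : Type*} {G : SimpleGraph V} {G' : SimpleGraph W} (e : G ≃g G')
    (k : ℕ) : colorWeights G k = colorWeights G' k := by
  apply Set.Subset.antisymm
  · rintro _ ⟨f, rfl⟩
    refine ⟨f.comp e.symm.toHom, ?_⟩
    funext i
    exact Nat.card_congr (e.symm.toEquiv.subtypeEquiv fun v => Iff.rfl)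
  · rintro _ ⟨f, rfl⟩
    refine ⟨f.comp e.toHom, ?_⟩
    funext i
    exact Nat.card_congr (e.toEquiv.subtypeEquiv fun v => Iff.rfl)

theorem colorWeights_comp_perm {V : Type*} {G : SimpleGraph V} {k : ℕ} {α : Fin k → ℕ}
    (hα : α ∈ colorWeights G k) (σ : Equiv.Perm (Fin k)) : α ∘ σ ∈ colorWeights G k := by
  obtain ⟨f, rfl⟩ := hα
  refine ⟨SimpleGraph.Coloring.mk (fun v => σ.symm (f v)) fun {u v} h he =>
    f.valid h (σ.symm.injective he), ?_⟩
  funext i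
  refine Nat.card_congr ((Equiv.refl V).subtypeEquiv fun v => ?_)
  exact Equiv.symm_apply_eq σ

section Poset

variable {P : Type*} [PartialOrder P]

theorem incompGraph_adj_iff {x y : P} : (incompGraph P).Adj x y ↔ ¬ x ≤ y ∧ ¬ y ≤ x := Iff.rfl

theorem not_incompGraph_adj {x y : P} (h : x < y ∨ y < x) : ¬ (incompGraph P).Adj x y := by
  rw [incompGraph_adj_iff]
  rcases h with h | h
  · exact fun h' => h'.1 h.le
  · exact fun h' => h'.2 h.le

theorem lt_or_lt_of_not_incompGraph_adj {x y : P} (hne : x ≠ y) (h : ¬ (incompGraph P).Adj x y) :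
    x < y ∨ y < x := by
  rw [incompGraph_adj_iff] at h
  by_cases hxy : x ≤ y
  · exact Or.inl (lt_of_le_of_ne hxy hne)
  · exact Or.inr (lt_of_le_of_ne (not_not.mp fun h' => h ⟨hxy, h'⟩) hne.symm)

theorem ChainSumFree.le_or_le (hP : ChainSumFree P 3 1) {x y z : P} (hxy : x < y) (hyz : y < z)
    (b : P) : x ≤ b ∨ b ≤ z := by
  by_contra! hcon
  obtain ⟨h1, h2⟩ := hcon
  refine hP ⟨![x, y, z], ![b], ?_, Subsingleton.strictMono _, ?_⟩
  · rw [Fin.strictMono_iff_lt_succ]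
    intro i
    fin_cases i
    · exact hxy
    · exact hyz
  · intro i j
    fin_cases j
    fin_cases i
    · exact ⟨h1, fun h => h2 (h.trans (hxy.trans hyz).le)⟩
    · exact ⟨fun h => h1 (hxy.le.trans h), fun h => h2 (h.trans hyz.le)⟩
    · exact ⟨fun h => h1 ((hxy.trans hyz).le.trans h), h2⟩

theorem exists_pairwise_lt_list (s : Finset P) (hs : ∀ x ∈ s, ∀ y ∈ s, x ≠ y → x < y ∨ y < x) :
    ∃ l : List P, l.Pairwise (· < ·) ∧ ∀ x, x ∈ l ↔ x ∈ s := by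
  classical
  induction hn : s.card generalizing s with
  | zero =>
    rw [Finset.card_eq_zero] at hn
    subst hn
    exact ⟨[], by simp, by simp⟩
  | succ n ih =>
    obtain ⟨m, hm⟩ := s.exists_minimal (Finset.card_pos.mp (by omega))
    obtain ⟨l, hl, hls⟩ := ih (s.erase m)
      (fun x hx y hy => hs x (Finset.mem_of_mem_erase hx) y (Finset.mem_of_mem_erase hy))
      (by rw [Finset.card_erase_of_mem hm.1]; omega)
    refine ⟨m :: l, List.pairwise_cons.mpr ⟨fun x hx => ?_, hl⟩, fun x => ?_⟩
    · rw [hls, Finset.mem_erase] at hx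
      rcases hs m hm.1 x hx.2 hx.1.symm with h | h
      · exact h
      · exact absurd h (hm.not_lt hx.2)
    · rw [List.mem_cons, hls, Finset.mem_erase]
      by_cases h : x = m
      · simp [h, hm.1]
      · simp [h]

theorem List.Pairwise.lt_or_lt {l : List P} (hl : l.Pairwise (· < ·)) {x y : P} (hx : x ∈ l)
    (hy : y ∈ l) (hxy : x ≠ y) : x < y ∨ y < x := by
  have h1 : l.Pairwise fun x y => x < y ∨ y < x := hl.imp Or.inl
  have : Std.Symm fun x y : P => x < y ∨ y < x := ⟨fun _ _ h => h.symm⟩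
  exact h1.forall hx hy hxy

/-- Two disjoint chains `ws, x, as` and `zs, bs` in a `(3+1)`-free poset can be cut in such a way
that exchanging the tails gives two chains again, and that equally many elements of `as` and of `bs`
come before the cuts. If the cut directly after `x` and directly before `bs` does not work, then
the `(3+1)`-free condition allows to move both cuts by one step. -/
theorem ChainSumFree.exists_tail_swap (hP : ChainSumFree P 3 1) (bs : List P) :
    ∀ (as ws zs : List P) (x : P), as.length = bs.length + 1 →
      (ws ++ x :: as).Pairwise (· < ·) → (zs ++ bs).Pairwise (· < ·) →
      (zs ++ as).Pairwise (· < ·) → (∀ p ∈ x :: as, p ∉ bs) →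
      ∃ as₁ as₂ bs₁ bs₂, as = as₁ ++ as₂ ∧ bs = bs₁ ++ bs₂ ∧ as₁.length = bs₁.length ∧
        (ws ++ x :: as₁ ++ bs₂).Pairwise (· < ·) ∧ (zs ++ bs₁ ++ as₂).Pairwise (· < ·) := by
  induction bs with
  | nil =>
    intro as ws zs x _ h1 _ h3 _
    refine ⟨[], as, [], [], rfl, rfl, rfl, ?_, by simpa using h3⟩
    rw [List.pairwise_append] at h1 ⊢
    simp only [List.pairwise_cons, List.mem_cons] at h1 ⊢
    refine ⟨?_, by simp, by simp⟩
    rw [List.pairwise_append]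
    exact ⟨h1.1, by simp, fun a ha b hb => h1.2.2 a ha b (Or.inl (by simpa using hb))⟩
  | cons b bs ih =>
    intro as ws zs x hlen h1 h2 h3 hdis
    by_cases hxb : x < b
    · refine ⟨[], as, [], b :: bs, rfl, rfl, rfl, ?_, by simpa using h3⟩
      simp only [List.pairwise_append, List.pairwise_cons, List.mem_append, List.mem_cons,
        List.not_mem_nil, or_false] at h1 h2 ⊢
      have hxbs : ∀ y, y = b ∨ y ∈ bs → x < y := by
        rintro y (rfl | hy)
        · exact hxb
        · exact hxb.trans (h2.2.1.1 y hy)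
      refine ⟨⟨h1.1, by simp, fun a ha c hc => h1.2.2 a ha c (Or.inl hc)⟩, h2.2.1, ?_⟩
      rintro a (ha | rfl) c hc
      · exact (h1.2.2 a ha x (Or.inl rfl)).trans (hxbs c hc)
      · exact hxbs c hc
    · obtain ⟨a₁, a₂, as, rfl⟩ : ∃ a₁ a₂ as', as = a₁ :: a₂ :: as' := by
        match as, hlen with
        | a₁ :: a₂ :: as', _ => exact ⟨a₁, a₂, as', rfl⟩
      have hb2 : b < a₂ := by
        simp only [List.pairwise_append, List.pairwise_cons, List.mem_cons] at h1
        rcases hP.le_or_le (h1.2.1.1 a₁ (Or.inl rfl)) (h1.2.1.2.1 a₂ (Or.inl rfl)) b with h | h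
        · refine absurd (lt_of_le_of_ne h ?_) hxb
          rintro rfl
          exact hdis x (by simp) (by simp)
        · refine lt_of_le_of_ne h ?_
          rintro rfl
          exact hdis b (by simp) (by simp)
      obtain ⟨as₁, as₂, bs₁, bs₂, e1, rfl, e3, h4, h5⟩ := ih (a₂ :: as) (ws ++ [x]) (zs ++ [b]) a₁
        (by simpa using hlen) (by simpa using h1) (by simpa using h2)
        (by
          simp only [List.pairwise_append, List.pairwise_cons, List.mem_append, List.mem_cons,
            List.not_mem_nil, or_false] at h2 h3 ⊢
          refine ⟨⟨h2.1, by simp, fun a ha c hc => h2.2.2 a ha c (Or.inl hc)⟩, h3.2.1.2, ?_⟩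
          rintro a (ha | rfl) c hc
          · exact h3.2.2 a ha c (Or.inr hc)
          · rcases hc with rfl | hc
            · exact hb2
            · exact hb2.trans (h3.2.1.2.1 c hc))
        (fun p hp hpb => hdis p (List.mem_cons_of_mem _ hp) (List.mem_cons_of_mem _ hpb))
      refine ⟨a₁ :: as₁, as₂, b :: bs₁, bs₂, by rw [e1]; rfl, rfl, by simp [e3], ?_, ?_⟩
      · simpa using h4
      · simpa using h5

variable [Fintype P]

/-- The weights of the proper colorings of the incomparability graph of a `(3+1)`-free poset are
closed under moving one unit from an entry to an entry smaller by at least `2`. -/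
theorem ChainSumFree.colorWeights_transfer (hP : ChainSumFree P 3 1) {k : ℕ} {α : Fin k → ℕ}
    (hα : α ∈ colorWeights (incompGraph P) k) {α' : Fin k → ℕ} {i j : Fin k}
    (h : IsTransfer α α' i j) : α' ∈ colorWeights (incompGraph P) k := by
  classical
  obtain ⟨f, rfl⟩ := hα
  have hw : ∀ (g : (incompGraph P).Coloring (Fin k)) (c : Fin k) (l : List P),
      l.Pairwise (· < ·) → (∀ x, x ∈ l ↔ g x = c) → colorWeight g c = l.length := by
    intro g c l hl hlc
    rw [colorWeight, Nat.card_eq_fintype_card, Fintype.card_subtype,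
      ← List.toFinset_card_of_nodup (hl.imp fun h => h.ne)]
    congr 1
    ext x
    simp [hlc]
  have hlist : ∀ c : Fin k, ∃ l : List P, l.Pairwise (· < ·) ∧ ∀ x, x ∈ l ↔ f x = c := by
    intro c
    obtain ⟨l, hl, hlc⟩ := exists_pairwise_lt_list (Finset.univ.filter fun x => f x = c) (by
      intro x hx y hy hne
      simp only [Finset.mem_filter, Finset.mem_univ, true_and] at hx hy
      exact lt_or_lt_of_not_incompGraph_adj hne fun hadj => f.valid hadj (hx.trans hy.symm))
    exact ⟨l, hl, by simpa using hlc⟩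
  obtain ⟨la, hla, hlai⟩ := hlist i
  obtain ⟨lb, hlb, hlbj⟩ := hlist j
  have hij := h.ne
  have hlen : lb.length + 2 ≤ la.length := by
    rw [← hw f i la hla hlai, ← hw f j lb hlb hlbj]
    exact h.two_le
  -- Cut `la` so that `lb.length + 1` elements come after `x`.
  obtain ⟨ws, x, as, rfl, has⟩ : ∃ ws x as, la = ws ++ x :: as ∧ as.length = lb.length + 1 := by
    have hd : (la.drop (la.length - (lb.length + 2))).length = lb.length + 2 := by
      rw [List.length_drop]
      omega
    match hdrop : la.drop (la.length - (lb.length + 2)), hd with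
    | x :: as, hd =>
      exact ⟨la.take (la.length - (lb.length + 2)), x, as, by rw [← hdrop, List.take_append_drop],
        by simpa using hd⟩
  obtain ⟨as₁, as₂, bs₁, bs₂, rfl, rfl, hl, hA, hB⟩ := hP.exists_tail_swap lb as ws [] x has hla
    (by simpa using hlb)
    (by
      rw [List.pairwise_append, List.pairwise_cons] at hla
      simpa using hla.2.1.2)
    (fun p hp hpb => by
      have h1 := (hlai p).mp (List.mem_append_right _ hp)
      have h2 := (hlbj p).mp hpb
      exact hij (h1.symm.trans h2))
  set A := ws ++ x :: as₁ ++ bs₂ with hAdef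
  set B := [] ++ bs₁ ++ as₂ with hBdef
  have hAB : ∀ y, (y ∈ A ∨ y ∈ B) ↔ (f y = i ∨ f y = j) := by
    intro y
    rw [← hlai, ← hlbj]
    simp only [hAdef, hBdef, List.mem_append, List.mem_cons, List.not_mem_nil, false_or]
    tauto
  have hdisj : ∀ y, y ∈ A → y ∉ B := by
    intro y hyA hyB
    have h1 : (ws ++ x :: (as₁ ++ as₂)).Nodup := hla.imp fun h => h.ne
    have h2 : (bs₁ ++ bs₂).Nodup := hlb.imp fun h => h.ne
    have h3 : ∀ z, z ∈ ws ++ x :: (as₁ ++ as₂) → z ∉ bs₁ ++ bs₂ := fun z hz1 hz2 =>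
      hij (((hlai z).mp hz1).symm.trans ((hlbj z).mp hz2))
    have h3 := h3 y
    simp only [hAdef, hBdef, List.mem_append, List.mem_cons, List.not_mem_nil, false_or,
      List.nodup_append, List.nodup_cons, not_or] at h1 h2 h3 hyA hyB
    obtain ⟨-, ⟨h5, -, -, h6⟩, h7⟩ := h1
    obtain ⟨-, -, h8⟩ := h2
    rcases hyB with hyB | hyB
    · rcases hyA with (hyA | rfl | hyA) | hyA
      · exact (h3 (by tauto)).1 hyB
      · exact (h3 (by tauto)).1 hyB
      · exact (h3 (by tauto)).1 hyB
      · exact h8 y hyB y hyA rfl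
    · rcases hyA with (hyA | rfl | hyA) | hyA
      · exact h7 y hyA y (by tauto) rfl
      · exact h5.2 hyB
      · exact h6 y hyA y hyB rfl
      · exact (h3 (by tauto)).2 hyA
  set g : P → Fin k := fun y => if y ∈ A then i else if y ∈ B then j else f y with hg
  have hgi : ∀ y, y ∈ A ↔ g y = i := by
    intro y
    by_cases h1 : y ∈ A
    · simp [hg, h1]
    · by_cases h2 : y ∈ B
      · simp [hg, h1, h2, hij.symm]
      · have := hAB y
        simp only [h1, h2, or_self, false_iff, not_or] at this
        simp [hg, h1, h2, this]
  have hgj : ∀ y, y ∈ B ↔ g y = j := by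
    intro y
    by_cases h1 : y ∈ A
    · simp [hg, h1, hij, hdisj y h1]
    · by_cases h2 : y ∈ B
      · simp [hg, h1, h2]
      · have := hAB y
        simp only [h1, h2, or_self, false_iff, not_or] at this
        simp [hg, h1, h2, this]
  have hgc : ∀ c, c ≠ i → c ≠ j → ∀ y, g y = c ↔ f y = c := by
    intro c hci hcj y
    have hAB := hAB y
    by_cases h1 : y ∈ A
    · simp only [h1, true_or, true_iff] at hAB
      simp only [hg, h1, if_true]
      constructor
      · exact fun h => absurd h.symm hci
      · rintro rfl
        tauto
    · by_cases h2 : y ∈ B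
      · simp only [h2, or_true, true_iff] at hAB
        simp only [hg, h1, h2, if_true, if_false]
        constructor
        · exact fun h => absurd h.symm hcj
        · rintro rfl
          tauto
      · simp [hg, h1, h2]
  let g' : (incompGraph P).Coloring (Fin k) := SimpleGraph.Coloring.mk g (by
    intro u v hadj heq
    have hne : u ≠ v := hadj.ne
    by_cases hi : g v = i
    · exact not_incompGraph_adj
        (hA.lt_or_lt ((hgi u).mpr (heq.trans hi)) ((hgi v).mpr hi) hne) hadj
    · by_cases hj : g v = j
      · exact not_incompGraph_adj
          (hB.lt_or_lt ((hgj u).mpr (heq.trans hj)) ((hgj v).mpr hj) hne) hadj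
      · have h1 := (hgc _ hi hj u).mp heq
        have h2 := (hgc _ hi hj v).mp rfl
        exact f.valid hadj (h1.trans h2.symm))
  refine ⟨g', funext fun c => ?_⟩
  by_cases hci : c = i
  · subst hci
    rw [hw g' c A hA hgi]
    have h1 := h.source
    rw [hw f c _ hla hlai] at h1
    simp [hAdef] at h1 has ⊢
    omega
  · by_cases hcj : c = j
    · subst hcj
      rw [hw g' c B hB hgj]
      have h1 := h.target
      rw [hw f c _ hlb hlbj] at h1
      simp [hBdef] at h1 has ⊢
      omega
    · rw [h.other c hci hcj]
      refine Nat.card_congr ((Equiv.refl P).subtypeEquiv fun y => ?_)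
      exact hgc c hci hcj y

end Poset

/-! ### Matchings and the number `topMatch` -/

section Matching

variable {r s : ℕ}

/-- A set of pairs is a matching if no two of its pairs share an entry. -/
def IsPairMatching {α β : Type*} (M : Finset (α × β)) : Prop :=
  ∀ e ∈ M, ∀ e' ∈ M, e.1 = e'.1 ∨ e.2 = e'.2 → e = e'

theorem IsPairMatching.mono {α β : Type*} {M N : Finset (α × β)} (hM : IsPairMatching M)
    (h : N ⊆ M) : IsPairMatching N :=
  fun e he e' he' => hM e (h he) e' (h he')

theorem mem_maxMatchings {M : Finset (Fin r × Fin s)} :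
    M ∈ maxMatchings r s ↔ M.card = min r s ∧ IsPairMatching M := by
  simp [maxMatchings, IsPairMatching]

theorem IsPairMatching.card_le {M : Finset (Fin r × Fin s)} (hM : IsPairMatching M) :
    M.card ≤ min r s := by
  refine le_min ?_ ?_
  · have h : (M.image Prod.fst).card = M.card :=
      Finset.card_image_of_injOn fun e he e' he' h => hM e he e' he' (Or.inl h)
    rw [← h]
    exact (Finset.card_le_univ _).trans (by simp)
  · have h : (M.image Prod.snd).card = M.card :=
      Finset.card_image_of_injOn fun e he e' he' h => hM e he e' he' (Or.inr h)
    rw [← h]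
    exact (Finset.card_le_univ _).trans (by simp)

theorem IsPairMatching.exists_maxMatching {M : Finset (Fin r × Fin s)} (hM : IsPairMatching M) :
    ∃ M' ∈ maxMatchings r s, M ⊆ M' := by
  induction hd : min r s - M.card generalizing M with
  | zero =>
    have := hM.card_le
    exact ⟨M, mem_maxMatchings.mpr ⟨by omega, hM⟩, subset_rfl⟩
  | succ d ih =>
    obtain ⟨a, ha⟩ : ∃ a, a ∉ M.image Prod.fst := by
      by_contra! hcon
      have h1 : (Finset.univ : Finset (Fin r)).card ≤ (M.image Prod.fst).card :=
        Finset.card_le_card fun a _ => hcon a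
      have h2 := Finset.card_image_le (s := M) (f := Prod.fst)
      rw [Finset.card_univ, Fintype.card_fin] at h1
      omega
    obtain ⟨b, hb⟩ : ∃ b, b ∉ M.image Prod.snd := by
      by_contra! hcon
      have h1 : (Finset.univ : Finset (Fin s)).card ≤ (M.image Prod.snd).card :=
        Finset.card_le_card fun a _ => hcon a
      have h2 := Finset.card_image_le (s := M) (f := Prod.snd)
      rw [Finset.card_univ, Fintype.card_fin] at h1
      omega
    have ha' : ∀ e ∈ M, e.1 ≠ a := fun e he h => ha (h ▸ Finset.mem_image_of_mem _ he)
    have hb' : ∀ e ∈ M, e.2 ≠ b := fun e he h => hb (h ▸ Finset.mem_image_of_mem _ he)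
    have hab : (a, b) ∉ M := fun h => ha' _ h rfl
    obtain ⟨M', hM', hsub⟩ := ih (M := insert (a, b) M) (by
      intro e he e' he' h
      rw [Finset.mem_insert] at he he'
      rcases he with rfl | he <;> rcases he' with rfl | he'
      · rfl
      · rcases h with h | h
        · exact absurd h.symm (ha' e' he')
        · exact absurd h.symm (hb' e' he')
      · rcases h with h | h
        · exact absurd h (ha' e he)
        · exact absurd h (hb' e he)
      · exact hM e he e' he' h) (by rw [Finset.card_insert_of_notMem hab]; omega)
    exact ⟨M', hM', (Finset.subset_insert _ _).trans hsub⟩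

theorem matchProb_ne_zero_iff {H : Finset (Fin r × Fin s)} {j : ℕ} :
    matchProb H j ≠ 0 ↔ ∃ M ∈ maxMatchings r s, (H ∩ M).card = j := by
  have h1 : (maxMatchings r s).card ≠ 0 := by
    obtain ⟨M, hM, -⟩ := IsPairMatching.exists_maxMatching (r := r) (s := s) (M := ∅)
      (by simp [IsPairMatching])
    exact Finset.card_ne_zero_of_mem hM
  simp only [matchProb, ne_eq, div_eq_zero_iff, Nat.cast_eq_zero, h1, or_false,
    Finset.card_eq_zero, ← Finset.nonempty_iff_ne_empty, Finset.Nonempty, Finset.mem_filter]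

theorem IsPairMatching.card_le_topMatch {H M : Finset (Fin r × Fin s)} (hM : IsPairMatching M)
    (hMH : M ⊆ H) : M.card ≤ topMatch H := by
  obtain ⟨M', hM', hsub⟩ := hM.exists_maxMatching
  have h1 : M.card ≤ (H ∩ M').card := Finset.card_le_card (Finset.subset_inter hMH hsub)
  refine h1.trans (Nat.le_findGreatest ?_ (matchProb_ne_zero_iff.mpr ⟨M', hM', rfl⟩))
  rw [← (mem_maxMatchings.mp hM').1]
  exact Finset.card_le_card Finset.inter_subset_right

/-- `topMatch H` is the matching number of `H`. -/
theorem exists_matching_card_eq_topMatch (H : Finset (Fin r × Fin s)) :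
    ∃ M ⊆ H, IsPairMatching M ∧ M.card = topMatch H := by
  obtain ⟨M₀, hM₀, -⟩ := IsPairMatching.exists_maxMatching (r := r) (s := s) (M := ∅)
    (by simp [IsPairMatching])
  have h1 : (H ∩ M₀).card ≤ min r s := by
    rw [← (mem_maxMatchings.mp hM₀).1]
    exact Finset.card_le_card Finset.inter_subset_right
  have h2 : matchProb H (topMatch H) ≠ 0 := Nat.findGreatest_spec
    (P := fun j => matchProb H j ≠ 0) h1 (matchProb_ne_zero_iff.mpr ⟨M₀, hM₀, rfl⟩)
  obtain ⟨M, hM, hMj⟩ := matchProb_ne_zero_iff.mp h2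
  exact ⟨H ∩ M, Finset.inter_subset_left, (mem_maxMatchings.mp hM).2.mono Finset.inter_subset_right,
    hMj⟩

theorem topMatch_le (H : Finset (Fin r × Fin s)) : topMatch H ≤ min r s :=
  Nat.findGreatest_le _

end Matching

/-! ### Colorings of part listings -/

namespace ListingPart

theorem Joined.ne {p : ListingPart} {a b : p.Vert} (h : p.Joined a b) : a ≠ b := by
  rintro rfl
  have := h.level_eq
  omega

theorem level_le_succ (p : ListingPart) (a b : p.Vert) : p.level b ≤ p.level a + 1 := by
  match p, a, b with
  | .vertex _, _, _ => exact Nat.le_succ _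
  | .bicolored _ _ _ _, .inl _, .inl _ => exact Nat.le_succ _
  | .bicolored _ _ _ _, .inl _, .inr _ => exact le_rfl
  | .bicolored _ _ _ _, .inr _, .inl _ => exact Nat.le_succ_of_le (Nat.le_succ _)
  | .bicolored _ _ _ _, .inr _, .inr _ => exact Nat.le_succ _

end ListingPart

section Pattern

variable {κ : Type*}

/-- `E` is the set of pairs (level, color) of some proper coloring of the part `p`. -/
def IsPartPattern (p : ListingPart) (E : Finset (ℕ × κ)) : Prop :=
  ∃ f : p.Vert → κ, (∀ a b, a ≠ b → f a = f b → p.Joined a b ∨ p.Joined b a) ∧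
    ∀ q, q ∈ E ↔ ∃ a, (p.level a, f a) = q

/-- `E` is the set of pairs (level, color) of some proper coloring of the poset of the part
listing `L`. -/
def IsPattern (L : List ListingPart) (E : Finset (ℕ × κ)) : Prop :=
  ∃ f : (incompGraph (PartListingPoset L)).Coloring κ,
    ∀ q, q ∈ E ↔ ∃ x, (PartListingPoset.level x, f x) = q

/-- Vertices with the same color whose level and color are listed in `E₁` and in `E₂` are comparable
if those from `E₁` belong to earlier parts than those from `E₂`. -/
def ColorCompatible (E₁ E₂ : Finset (ℕ × κ)) : Prop :=
  ∀ u ∈ E₁, ∀ v ∈ E₂, u.2 = v.2 → u.1 + 1 ≤ v.1 ∨ v.1 + 2 ≤ u.1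

namespace PartListingPoset

variable {p : ListingPart} {L : List ListingPart}

/-- The inclusion of the first part. -/
def head (a : p.Vert) : PartListingPoset (p :: L) := ⟨⟨0, Nat.succ_pos _⟩, a⟩

/-- The inclusion of all parts but the first. -/
def tail (x : PartListingPoset L) : PartListingPoset (p :: L) := ⟨x.1.succ, x.2⟩

theorem head_or_tail (x : PartListingPoset (p :: L)) :
    (∃ a, x = head a) ∨ ∃ y, x = tail y := by
  rcases x with ⟨⟨_ | i, hi⟩, a⟩
  · exact Or.inl ⟨a, rfl⟩
  · exact Or.inr ⟨⟨⟨i, Nat.lt_of_succ_lt_succ hi⟩, a⟩, rfl⟩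

theorem level_head (a : p.Vert) : level (head a : PartListingPoset (p :: L)) = p.level a := rfl

theorem level_tail (x : PartListingPoset L) :
    level (tail x : PartListingPoset (p :: L)) = level x := rfl

theorem head_injective :
    Function.Injective (head : p.Vert → PartListingPoset (p :: L)) := by
  intro a b h
  exact eq_of_heq (Sigma.mk.inj h).2

theorem tail_injective :
    Function.Injective (tail : PartListingPoset L → PartListingPoset (p :: L)) := by
  rintro ⟨i, a⟩ ⟨j, b⟩ h
  obtain ⟨h1, h2⟩ := Sigma.mk.inj h
  obtain rfl := Fin.succ_injective _ h1
  obtain rfl := eq_of_heq h2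
  rfl

theorem lt_iff_below {x y : PartListingPoset L} : x < y ↔ Below x y := Iff.rfl

/-- Inside one part, the order is given by the joined pairs. -/
theorem below_mk_mk_iff {i : Fin L.length} {a b : (L.get i).Vert} :
    Below (L := L) ⟨i, a⟩ ⟨i, b⟩ ↔ (L.get i).Joined a b := by
  constructor
  · rintro (h | ⟨-, h⟩ | ⟨j, c, d, h1, h2, h3⟩)
    · have := (L.get i).level_le_succ a b
      simp only [level] at h
      omega
    · exact absurd h (lt_irrefl _)
    · obtain ⟨rfl, h1⟩ := Sigma.mk.inj h1
      obtain rfl := eq_of_heq h1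
      obtain rfl := eq_of_heq (Sigma.mk.inj h2).2
      exact h3
  · exact fun h => Or.inr (Or.inr ⟨i, a, b, rfl, rfl, h⟩)

/-- Between different parts, the order is determined by the levels and the order of the parts. -/
theorem lt_iff_of_ne {x y : PartListingPoset L} (h : x.1 ≠ y.1) :
    x < y ↔ level x + 2 ≤ level y ∨ (level x + 1 = level y ∧ x.1 < y.1) := by
  rw [lt_iff_below]
  constructor
  · rintro (h1 | h1 | ⟨j, c, d, rfl, rfl, -⟩)
    · exact Or.inl h1
    · exact Or.inr h1
    · exact absurd rfl h
  · rintro (h1 | h1)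
    · exact Or.inl h1
    · exact Or.inr (Or.inl h1)

theorem head_lt_head {a b : p.Vert} :
    (head a : PartListingPoset (p :: L)) < head b ↔ p.Joined a b :=
  below_mk_mk_iff (L := p :: L) (i := ⟨0, Nat.succ_pos _⟩)

theorem tail_lt_tail {x y : PartListingPoset L} :
    (tail x : PartListingPoset (p :: L)) < tail y ↔ x < y := by
  by_cases h : x.1 = y.1
  · rcases x with ⟨i, a⟩
    rcases y with ⟨j, b⟩
    obtain rfl : i = j := h
    exact (below_mk_mk_iff (L := p :: L) (i := i.succ)).trans
      (below_mk_mk_iff (L := L) (i := i) (a := a) (b := b)).symm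
  · rw [lt_iff_of_ne h, lt_iff_of_ne (fun h' => h (Fin.succ_injective _ h'))]
    rw [level_tail, level_tail]
    exact or_congr_right (and_congr_right fun _ => Fin.succ_lt_succ_iff)

theorem head_ne_tail_fst {a : p.Vert} {x : PartListingPoset L} :
    (head a : PartListingPoset (p :: L)).1 ≠ (tail x : PartListingPoset (p :: L)).1 :=
  fun h => (Fin.succ_ne_zero x.1) h.symm

theorem head_lt_tail {a : p.Vert} {x : PartListingPoset L} :
    (head a : PartListingPoset (p :: L)) < tail x ↔ p.level a + 1 ≤ level x := by
  rw [lt_iff_of_ne head_ne_tail_fst, level_head, level_tail]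
  have : (head a : PartListingPoset (p :: L)).1 < (tail x : PartListingPoset (p :: L)).1 :=
    Fin.succ_pos x.1
  simp only [this, and_true]
  omega

theorem tail_lt_head {a : p.Vert} {x : PartListingPoset L} :
    (tail x : PartListingPoset (p :: L)) < head a ↔ level x + 2 ≤ p.level a := by
  rw [lt_iff_of_ne head_ne_tail_fst.symm, level_head, level_tail]
  have : ¬ (tail x : PartListingPoset (p :: L)).1 < (head a : PartListingPoset (p :: L)).1 :=
    not_lt.mpr (Fin.succ_pos x.1).le
  simp only [this, and_false, or_false]

end PartListingPoset

open PartListingPoset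

theorem isPattern_nil {E : Finset (ℕ × κ)} : IsPattern [] E ↔ E = ∅ := by
  constructor
  · rintro ⟨f, hf⟩
    refine Finset.eq_empty_of_forall_notMem fun q hq => ?_
    obtain ⟨x, -⟩ := (hf q).mp hq
    exact x.1.elim0
  · rintro rfl
    refine ⟨SimpleGraph.Coloring.mk (fun x => x.1.elim0) fun {x} => x.1.elim0, fun q => ?_⟩
    simp only [Finset.notMem_empty, false_iff]
    rintro ⟨x, -⟩
    exact x.1.elim0

theorem isPartPattern_vertex {i : ℕ} {E : Finset (ℕ × κ)} :
    IsPartPattern (.vertex i) E ↔ ∃ c, E = {(i, c)} := by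
  constructor
  · rintro ⟨f, -, hf⟩
    refine ⟨f (), Finset.ext fun q => ?_⟩
    rw [hf, Finset.mem_singleton]
    exact ⟨fun ⟨_, h⟩ => h.symm, fun h => ⟨(), h.symm⟩⟩
  · rintro ⟨c, rfl⟩
    refine ⟨fun _ => c, fun a b h => absurd rfl h, fun q => ?_⟩
    rw [Finset.mem_singleton]
    exact ⟨fun h => ⟨(), h.symm⟩, fun ⟨_, h⟩ => h.symm⟩

variable [DecidableEq κ]

theorem colorCompatible_union_left {E₁ E₂ E₃ : Finset (ℕ × κ)} :
    ColorCompatible (E₁ ∪ E₂) E₃ ↔ ColorCompatible E₁ E₃ ∧ ColorCompatible E₂ E₃ := by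
  simp only [ColorCompatible, Finset.mem_union]
  exact ⟨fun h => ⟨fun u hu => h u (Or.inl hu), fun u hu => h u (Or.inr hu)⟩,
    fun h u hu => hu.elim (h.1 u) (h.2 u)⟩

theorem colorCompatible_union_right {E₁ E₂ E₃ : Finset (ℕ × κ)} :
    ColorCompatible E₁ (E₂ ∪ E₃) ↔ ColorCompatible E₁ E₂ ∧ ColorCompatible E₁ E₃ := by
  simp only [ColorCompatible, Finset.mem_union]
  exact ⟨fun h => ⟨fun u hu v hv => h u hu v (Or.inl hv), fun u hu v hv => h u hu v (Or.inr hv)⟩,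
    fun h u hu v hv => hv.elim (h.1 u hu v) (h.2 u hu v)⟩

/-- A coloring of a nonempty part listing is a coloring of its first part together with a compatible
coloring of the remaining parts. -/
theorem isPattern_cons {p : ListingPart} {L : List ListingPart} {E : Finset (ℕ × κ)} :
    IsPattern (p :: L) E ↔
      ∃ E₁ E₂, IsPartPattern p E₁ ∧ IsPattern L E₂ ∧ ColorCompatible E₁ E₂ ∧ E = E₁ ∪ E₂ := by
  classical
  constructor
  · rintro ⟨f, hf⟩
    let g : (incompGraph (PartListingPoset L)).Coloring κ :=
      SimpleGraph.Coloring.mk (fun x => f (tail x)) (by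
        intro x y hadj heq
        refine f.valid (v := tail x) (w := tail y) ?_ heq
        by_contra hcon
        refine not_incompGraph_adj ?_ hadj
        have := lt_or_lt_of_not_incompGraph_adj (tail_injective.ne hadj.ne) hcon
        rwa [tail_lt_tail, tail_lt_tail] at this)
    refine ⟨E.filter fun q => ∃ a : p.Vert, (p.level a, f (head a)) = q,
      E.filter fun q => ∃ x : PartListingPoset L, (level x, f (tail x)) = q,
      ⟨fun a => f (head a), ?_, ?_⟩, ⟨g, ?_⟩, ?_, ?_⟩
    · intro a b hne heq
      have := lt_or_lt_of_not_incompGraph_adj (head_injective.ne hne)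
        (fun hadj => f.valid hadj heq : ¬ (incompGraph (PartListingPoset (p :: L))).Adj _ _)
      rwa [head_lt_head, head_lt_head] at this
    · intro q
      rw [Finset.mem_filter]
      refine ⟨fun h => h.2, fun h => ⟨?_, h⟩⟩
      obtain ⟨a, ha⟩ := h
      exact (hf q).mpr ⟨head a, ha⟩
    · intro q
      rw [Finset.mem_filter]
      refine ⟨fun h => h.2, fun h => ⟨?_, h⟩⟩
      obtain ⟨x, hx⟩ := h
      exact (hf q).mpr ⟨tail x, hx⟩
    · intro u hu v hv huv
      rw [Finset.mem_filter] at hu hv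
      obtain ⟨-, a, rfl⟩ := hu
      obtain ⟨-, x, rfl⟩ := hv
      have := lt_or_lt_of_not_incompGraph_adj
        (fun h => head_ne_tail_fst (congrArg Sigma.fst h) : (head a : PartListingPoset (p :: L)) ≠
          tail x) (fun hadj => f.valid hadj huv)
      rwa [head_lt_tail, tail_lt_head] at this
    · ext q
      rw [Finset.mem_union, Finset.mem_filter, Finset.mem_filter, ← and_or_left]
      refine ⟨fun h => ⟨h, ?_⟩, fun h => h.1⟩
      obtain ⟨x, hx⟩ := (hf q).mp h
      rcases head_or_tail x with ⟨a, rfl⟩ | ⟨y, rfl⟩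
      · exact Or.inl ⟨a, hx⟩
      · exact Or.inr ⟨y, hx⟩
  · rintro ⟨E₁, E₂, ⟨f, hf, hfE⟩, ⟨g, hgE⟩, hcomp, rfl⟩
    -- The two colorings are glued along `head_or_tail`.
    let F : PartListingPoset (p :: L) → κ := fun x =>
      if h : ∃ a, x = head a then f h.choose else
        g ((head_or_tail x).resolve_left h).choose
    have hFh : ∀ a, F (head a) = f a := by
      intro a
      have h : ∃ b, (head a : PartListingPoset (p :: L)) = head b := ⟨a, rfl⟩
      simp only [F, dif_pos h]
      exact congrArg f (head_injective h.choose_spec).symm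
    have hFt : ∀ x, F (tail x) = g x := by
      intro x
      have h : ¬ ∃ b, (tail x : PartListingPoset (p :: L)) = head b := by
        rintro ⟨b, hb⟩
        exact head_ne_tail_fst (congrArg Sigma.fst hb).symm
      simp only [F, dif_neg h]
      exact congrArg g (tail_injective ((head_or_tail (tail x)).resolve_left h).choose_spec).symm
    have hvalid : ∀ x y, x ≠ y → F x = F y → x < y ∨ y < x := by
      intro x y hne heq
      rcases head_or_tail x with ⟨a, rfl⟩ | ⟨x, rfl⟩ <;>
        rcases head_or_tail y with ⟨b, rfl⟩ | ⟨y, rfl⟩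
      · rw [hFh, hFh] at heq
        rw [head_lt_head, head_lt_head]
        exact hf a b (fun h => hne (h ▸ rfl)) heq
      · rw [hFh, hFt] at heq
        rw [head_lt_tail, tail_lt_head]
        exact hcomp _ ((hfE _).mpr ⟨a, rfl⟩) _ ((hgE _).mpr ⟨y, rfl⟩) heq
      · rw [hFh, hFt] at heq
        rw [head_lt_tail, tail_lt_head]
        exact (hcomp _ ((hfE _).mpr ⟨b, rfl⟩) _ ((hgE _).mpr ⟨x, rfl⟩) heq.symm).symm
      · rw [hFt, hFt] at heq
        rw [tail_lt_tail, tail_lt_tail]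
        exact lt_or_lt_of_not_incompGraph_adj (fun h => hne (h ▸ rfl)) fun hadj =>
          g.valid hadj heq
    refine ⟨SimpleGraph.Coloring.mk F fun {x y} hadj heq =>
      not_incompGraph_adj (hvalid x y hadj.ne heq) hadj, fun q => ?_⟩
    rw [Finset.mem_union, hfE, hgE]
    constructor
    · rintro (⟨a, rfl⟩ | ⟨x, rfl⟩)
      · exact ⟨head a, by rw [level_head]; exact congrArg _ (hFh a)⟩
      · exact ⟨tail x, by rw [level_tail]; exact congrArg _ (hFt x)⟩
    · rintro ⟨x, rfl⟩
      rcases head_or_tail x with ⟨a, rfl⟩ | ⟨x, rfl⟩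
      · exact Or.inl ⟨a, by rw [level_head]; exact congrArg _ (hFh a).symm⟩
      · exact Or.inr ⟨x, by rw [level_tail]; exact congrArg _ (hFt x).symm⟩

theorem isPattern_append {L L' : List ListingPart} {E : Finset (ℕ × κ)} :
    IsPattern (L ++ L') E ↔
      ∃ E₁ E₂, IsPattern L E₁ ∧ IsPattern L' E₂ ∧ ColorCompatible E₁ E₂ ∧ E = E₁ ∪ E₂ := by
  induction L generalizing E with
  | nil =>
    simp only [List.nil_append, isPattern_nil]
    constructor
    · exact fun h => ⟨∅, E, rfl, h, by simp [ColorCompatible], by simp⟩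
    · rintro ⟨_, E₂, rfl, h, -, rfl⟩
      simpa using h
  | cons p L ih =>
    rw [List.cons_append, isPattern_cons]
    constructor
    · rintro ⟨E₁, E₂, h1, h2, h3, rfl⟩
      obtain ⟨E₃, E₄, h4, h5, h6, rfl⟩ := ih.mp h2
      rw [colorCompatible_union_right] at h3
      exact ⟨E₁ ∪ E₃, E₄, isPattern_cons.mpr ⟨E₁, E₃, h1, h4, h3.1, rfl⟩, h5,
        colorCompatible_union_left.mpr ⟨h3.2, h6⟩, (Finset.union_assoc _ _ _).symm⟩
    · rintro ⟨E₁, E₂, h1, h2, h3, rfl⟩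
      obtain ⟨E₃, E₄, h4, h5, h6, rfl⟩ := isPattern_cons.mp h1
      rw [colorCompatible_union_left] at h3
      exact ⟨E₃, E₄ ∪ E₂, h4, ih.mpr ⟨E₄, E₂, h5, h2, h3.2, rfl⟩,
        colorCompatible_union_right.mpr ⟨h6, h3.1⟩, Finset.union_assoc _ _ _⟩

theorem isPattern_singleton {p : ListingPart} {E : Finset (ℕ × κ)} :
    IsPattern [p] E ↔ IsPartPattern p E := by
  rw [isPattern_cons]
  constructor
  · rintro ⟨E₁, E₂, h1, h2, -, rfl⟩
    rw [isPattern_nil.mp h2, Finset.union_empty]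
    exact h1
  · exact fun h => ⟨E, ∅, h, isPattern_nil.mpr rfl, by simp [ColorCompatible], by simp⟩

theorem isPattern_replicate {m i : ℕ} {E : Finset (ℕ × κ)} :
    IsPattern (List.replicate m (.vertex i)) E ↔ ∃ S : Finset κ, S.card = m ∧ E = {i} ×ˢ S := by
  induction m generalizing E with
  | zero =>
    rw [List.replicate_zero, isPattern_nil]
    constructor
    · rintro rfl
      exact ⟨∅, by simp⟩
    · rintro ⟨S, h1, rfl⟩
      rw [Finset.card_eq_zero.mp h1]
      simp
  | succ m ih =>
    rw [List.replicate_succ, isPattern_cons]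
    constructor
    · rintro ⟨E₁, E₂, h1, h2, h3, rfl⟩
      obtain ⟨c, rfl⟩ := isPartPattern_vertex.mp h1
      obtain ⟨S, rfl, rfl⟩ := ih.mp h2
      have hc : c ∉ S := by
        intro hc
        have := h3 (i, c) (by simp) (i, c) (by simp [hc]) rfl
        omega
      refine ⟨insert c S, Finset.card_insert_of_notMem hc, ?_⟩
      ext ⟨a, b⟩
      simp only [Finset.mem_union, Finset.mem_singleton, Prod.mk.injEq, Finset.mem_product,
        Finset.mem_insert]
      tauto
    · rintro ⟨S, hS, rfl⟩
      obtain ⟨c, T, hc, rfl, hT⟩ := Finset.card_eq_succ.mp hS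
      refine ⟨{(i, c)}, {i} ×ˢ T, isPartPattern_vertex.mpr ⟨c, rfl⟩, ih.mpr ⟨T, hT, rfl⟩, ?_, ?_⟩
      · intro u hu v hv huv
        simp only [Finset.mem_singleton, Finset.mem_product] at hu hv
        subst hu
        exact absurd hv.2 (huv ▸ hc)
      · ext ⟨a, b⟩
        simp only [Finset.mem_union, Finset.mem_singleton, Prod.mk.injEq, Finset.mem_product,
          Finset.mem_insert]
        tauto

/-- The possible patterns of a bicolored graph: the colors that occur on both levels are the colors
of the edges of a matching of the graph. -/
theorem isPartPattern_bicolored {i r s : ℕ} {H : Finset (Fin r × Fin s)} {E : Finset (ℕ × κ)} :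
    IsPartPattern (.bicolored i r s H) E ↔ ∃ R S : Finset κ, R.card = r ∧ S.card = s ∧
      (R ∩ S).card ≤ topMatch H ∧ E = {i} ×ˢ R ∪ {i + 1} ×ˢ S := by
  constructor
  · rintro ⟨f, hf, hfE⟩
    change Fin r ⊕ Fin s → κ at f
    have hinl : Function.Injective fun a : Fin r => f (.inl a) := by
      intro a b h
      by_contra hne
      rcases hf (.inl a) (.inl b) (fun h' => hne (Sum.inl_injective h')) h with h | h <;> exact h
    have hinr : Function.Injective fun a : Fin s => f (.inr a) := by
      intro a b h
      by_contra hne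
      rcases hf (.inr a) (.inr b) (fun h' => hne (Sum.inr_injective h')) h with h | h <;> exact h
    refine ⟨Finset.univ.image fun a => f (.inl a), Finset.univ.image fun b => f (.inr b), ?_, ?_, ?_,
      ?_⟩
    · rw [Finset.card_image_of_injective _ hinl, Finset.card_univ, Fintype.card_fin]
    · rw [Finset.card_image_of_injective _ hinr, Finset.card_univ, Fintype.card_fin]
    · let M : Finset (Fin r × Fin s) := Finset.univ.filter fun e => f (.inl e.1) = f (.inr e.2)
      have hM : IsPairMatching M := by
        intro e he e' he' h
        simp only [M, Finset.mem_filter, Finset.mem_univ, true_and] at he he'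
        rcases h with h | h
        · exact Prod.ext h (hinr (by rw [h] at he; exact he.symm.trans he'))
        · exact Prod.ext (hinl (by rw [h] at he; exact he.trans he'.symm)) h
      have hMH : M ⊆ H := by
        intro e he
        simp only [M, Finset.mem_filter, Finset.mem_univ, true_and] at he
        rcases hf (.inl e.1) (.inr e.2) (fun h => by cases h) he with h | h
        · exact h
        · exact h.elim
      refine le_trans ?_ (hM.card_le_topMatch hMH)
      refine le_trans (Finset.card_le_card ?_) (Finset.card_image_le (f := fun e => f (.inl e.1)))
      intro c hc
      simp only [Finset.mem_inter, Finset.mem_image, Finset.mem_univ, true_and] at hc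
      obtain ⟨⟨a, rfl⟩, b, hb⟩ := hc
      exact Finset.mem_image.mpr ⟨(a, b), by simp [M, hb], rfl⟩
    · ext ⟨l, c⟩
      rw [hfE]
      simp only [Finset.mem_union, Finset.mem_product, Finset.mem_singleton, Finset.mem_image,
        Finset.mem_univ, true_and]
      constructor
      · rintro ⟨a | b, h⟩
        · exact Or.inl ⟨(congrArg Prod.fst h).symm, a, congrArg Prod.snd h⟩
        · exact Or.inr ⟨(congrArg Prod.fst h).symm, b, congrArg Prod.snd h⟩
      · rintro (⟨rfl, a, rfl⟩ | ⟨rfl, b, rfl⟩)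
        · exact ⟨.inl a, rfl⟩
        · exact ⟨.inr b, rfl⟩
  · rintro ⟨R, S, hR, hS, hRS, rfl⟩
    obtain ⟨M, hMH, hM, hMc⟩ := exists_matching_card_eq_topMatch H
    obtain ⟨N, hNM, hNc⟩ := Finset.exists_subset_card_eq (hMc ▸ hRS)
    have hN := hM.mono hNM
    -- The edges of the matching `N` are given the common colors of `R` and `S`.
    let g : N ≃ (R ∩ S : Finset κ) := Finset.equivOfCardEq hNc
    by_cases hκ : Nonempty κ
    swap
    · have hR0 : R = ∅ := Finset.eq_empty_of_forall_notMem fun c => absurd ⟨c⟩ hκ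
      have hS0 : S = ∅ := Finset.eq_empty_of_forall_notMem fun c => absurd ⟨c⟩ hκ
      subst hR0 hS0
      obtain rfl : 0 = r := hR
      obtain rfl : 0 = s := hS
      refine ⟨fun x => (Sum.elim Fin.elim0 Fin.elim0 : Fin 0 ⊕ Fin 0 → κ) x,
        fun a => (Sum.elim Fin.elim0 Fin.elim0 a : _), fun q => ?_⟩
      simp only [Finset.product_empty, Finset.union_empty, Finset.notMem_empty, false_iff]
      rintro ⟨a | a, -⟩ <;> exact a.elim0
    let c₀ := Classical.choice hκ
    let f₁ : Fin r → κ := fun a => if h : ∃ e : N, e.1.1 = a then (g h.choose).1 else c₀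
    let f₂ : Fin s → κ := fun b => if h : ∃ e : N, e.1.2 = b then (g h.choose).1 else c₀
    have hf₁ : ∀ e : N, f₁ e.1.1 = g e := by
      intro e
      have h : ∃ e' : N, e'.1.1 = e.1.1 := ⟨e, rfl⟩
      simp only [f₁, dif_pos h]
      rw [Subtype.ext (hN _ h.choose.2 _ e.2 (Or.inl h.choose_spec))]
    have hf₂ : ∀ e : N, f₂ e.1.2 = g e := by
      intro e
      have h : ∃ e' : N, e'.1.2 = e.1.2 := ⟨e, rfl⟩
      simp only [f₂, dif_pos h]
      rw [Subtype.ext (hN _ h.choose.2 _ e.2 (Or.inr h.choose_spec))]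
    obtain ⟨F₁, hF₁⟩ := Finset.exists_equiv_extend_of_card_eq (α := Fin r) (t := R)
      (by rw [Fintype.card_fin, hR]) (s := N.image Prod.fst) (f := f₁)
      (by
        intro c hc
        simp only [Finset.mem_image] at hc
        obtain ⟨_, ⟨e, he, rfl⟩, rfl⟩ := hc
        rw [hf₁ ⟨e, he⟩]
        exact (Finset.mem_inter.mp (g ⟨e, he⟩).2).1)
      (by
        intro a ha b hb hab
        simp only [Finset.coe_image, Set.mem_image] at ha hb
        obtain ⟨e, he, rfl⟩ := ha
        obtain ⟨e', he', rfl⟩ := hb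
        rw [hf₁ ⟨e, he⟩, hf₁ ⟨e', he'⟩] at hab
        have := g.injective (Subtype.ext hab)
        exact congrArg (fun e : N => e.1.1) this)
    obtain ⟨F₂, hF₂⟩ := Finset.exists_equiv_extend_of_card_eq (α := Fin s) (t := S)
      (by rw [Fintype.card_fin, hS]) (s := N.image Prod.snd) (f := f₂)
      (by
        intro c hc
        simp only [Finset.mem_image] at hc
        obtain ⟨_, ⟨e, he, rfl⟩, rfl⟩ := hc
        rw [hf₂ ⟨e, he⟩]
        exact (Finset.mem_inter.mp (g ⟨e, he⟩).2).2)
      (by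
        intro a ha b hb hab
        simp only [Finset.coe_image, Set.mem_image] at ha hb
        obtain ⟨e, he, rfl⟩ := ha
        obtain ⟨e', he', rfl⟩ := hb
        rw [hf₂ ⟨e, he⟩, hf₂ ⟨e', he'⟩] at hab
        have := g.injective (Subtype.ext hab)
        exact congrArg (fun e : N => e.1.2) this)
    have hedge : ∀ a b, (F₁ a : κ) = F₂ b → (a, b) ∈ H := by
      intro a b hab
      have hc : (F₁ a : κ) ∈ R ∩ S := Finset.mem_inter.mpr ⟨(F₁ a).2, hab ▸ (F₂ b).2⟩
      obtain ⟨e, he⟩ := g.surjective ⟨_, hc⟩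
      have h1 : F₁ e.1.1 = F₁ a := Subtype.ext (by
        rw [hF₁ _ (Finset.mem_image_of_mem _ e.2), hf₁, he])
      have h2 : F₂ e.1.2 = F₂ b := Subtype.ext (by
        rw [hF₂ _ (Finset.mem_image_of_mem _ e.2), hf₂, he, hab])
      rw [← F₁.injective h1, ← F₂.injective h2]
      exact hMH (hNM e.2)
    refine ⟨fun x => (Sum.elim (fun a => (F₁ a : κ)) (fun b => (F₂ b : κ)) : Fin r ⊕ Fin s → κ) x,
      ?_, ?_⟩
    · rintro (a | a) (b | b) hne heq
      · exact absurd (congrArg Sum.inl (F₁.injective (Subtype.ext heq))) hne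
      · exact Or.inl (hedge a b heq)
      · exact Or.inr (hedge b a heq.symm)
      · exact absurd (congrArg Sum.inr (F₂.injective (Subtype.ext heq))) hne
    · rintro ⟨l, c⟩
      simp only [Finset.mem_union, Finset.mem_product, Finset.mem_singleton]
      constructor
      · rintro (⟨rfl, hc⟩ | ⟨rfl, hc⟩)
        · obtain ⟨a, ha⟩ := F₁.surjective ⟨c, hc⟩
          exact ⟨.inl a, Prod.ext rfl (congrArg Subtype.val ha)⟩
        · obtain ⟨a, ha⟩ := F₂.surjective ⟨c, hc⟩
          exact ⟨.inr a, Prod.ext rfl (congrArg Subtype.val ha)⟩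
      · rintro ⟨a | b, h⟩
        · obtain ⟨rfl, rfl⟩ := Prod.mk.inj h
          exact Or.inl ⟨rfl, (F₁ a).2⟩
        · obtain ⟨rfl, rfl⟩ := Prod.mk.inj h
          exact Or.inr ⟨rfl, (F₂ b).2⟩

theorem isPattern_listU {i r s j : ℕ} (hj : j ≤ s) {E : Finset (ℕ × κ)} :
    IsPattern (listU i r s j) E ↔ ∃ R S : Finset κ, R.card = r ∧ S.card = s ∧
      (R ∩ S).card ≤ j ∧ E = {i} ×ˢ R ∪ {i + 1} ×ˢ S := by
  rw [listU, isPattern_append]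
  constructor
  · rintro ⟨E₁, E₂, h1, h2, h3, rfl⟩
    obtain ⟨E₃, E₄, h4, h5, h6, rfl⟩ := isPattern_append.mp h1
    obtain ⟨S₁, hS₁, rfl⟩ := isPattern_replicate.mp h4
    obtain ⟨R, hR, rfl⟩ := isPattern_replicate.mp h5
    obtain ⟨S₂, hS₂, rfl⟩ := isPattern_replicate.mp h2
    rw [colorCompatible_union_left] at h3
    have hd1 : Disjoint S₁ S₂ := Finset.disjoint_left.mpr fun c h h' => by
      have := h3.1 (i + 1, c) (by simp [h]) (i + 1, c) (by simp [h']) rfl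
      omega
    have hd2 : Disjoint S₁ R := Finset.disjoint_left.mpr fun c h h' => by
      have := h6 (i + 1, c) (by simp [h]) (i, c) (by simp [h']) rfl
      omega
    refine ⟨R, S₁ ∪ S₂, hR, ?_, ?_, ?_⟩
    · rw [Finset.card_union_of_disjoint hd1]
      omega
    · rw [Finset.inter_union_distrib_left, Finset.disjoint_iff_inter_eq_empty.mp hd2.symm,
        Finset.empty_union, ← hS₂]
      exact Finset.card_le_card Finset.inter_subset_right
    · ext ⟨a, b⟩
      simp only [Finset.mem_union, Finset.mem_product]
      tauto
  · rintro ⟨R, S, hR, hS, hRS, rfl⟩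
    -- `T` holds the colors of the upper vertices that come after the lower ones.
    obtain ⟨T, hT1, hT2, hTc⟩ := Finset.exists_subsuperset_card_eq
      (Finset.inter_subset_right : R ∩ S ⊆ S) hRS (hS ▸ hj)
    refine ⟨{i + 1} ×ˢ (S \ T) ∪ {i} ×ˢ R, {i + 1} ×ˢ T, isPattern_append.mpr
      ⟨_, _, isPattern_replicate.mpr ⟨S \ T, ?_, rfl⟩, isPattern_replicate.mpr ⟨R, hR, rfl⟩, ?_,
        rfl⟩, isPattern_replicate.mpr ⟨T, hTc, rfl⟩, ?_, ?_⟩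
    · rw [Finset.card_sdiff_of_subset hT2, hS, hTc]
    · intro u hu v hv huv
      simp only [Finset.mem_product, Finset.mem_singleton, Finset.mem_sdiff] at hu hv
      exact absurd (hT1 (Finset.mem_inter.mpr ⟨huv ▸ hv.2, hu.2.1⟩)) hu.2.2
    · rw [colorCompatible_union_left]
      constructor
      · intro u hu v hv huv
        simp only [Finset.mem_product, Finset.mem_singleton, Finset.mem_sdiff] at hu hv
        exact absurd (huv ▸ hv.2) hu.2.2
      · intro u hu v hv huv
        simp only [Finset.mem_product, Finset.mem_singleton] at hu hv
        omega
    · ext ⟨a, b⟩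
      have := @hT2 b
      simp only [Finset.mem_union, Finset.mem_product, Finset.mem_sdiff]
      tauto

theorem isPattern_listD {i r s j : ℕ} (hj : j ≤ r) {E : Finset (ℕ × κ)} :
    IsPattern (listD i r s j) E ↔ ∃ R S : Finset κ, R.card = r ∧ S.card = s ∧
      (R ∩ S).card ≤ j ∧ E = {i} ×ˢ R ∪ {i + 1} ×ˢ S := by
  rw [listD, isPattern_append]
  constructor
  · rintro ⟨E₁, E₂, h1, h2, h3, rfl⟩
    obtain ⟨E₃, E₄, h4, h5, h6, rfl⟩ := isPattern_append.mp h1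
    obtain ⟨R₁, hR₁, rfl⟩ := isPattern_replicate.mp h4
    obtain ⟨S, hS, rfl⟩ := isPattern_replicate.mp h5
    obtain ⟨R₂, hR₂, rfl⟩ := isPattern_replicate.mp h2
    rw [colorCompatible_union_left] at h3
    have hd1 : Disjoint R₁ R₂ := Finset.disjoint_left.mpr fun c h h' => by
      have := h3.1 (i, c) (by simp [h]) (i, c) (by simp [h']) rfl
      omega
    have hd2 : Disjoint S R₂ := Finset.disjoint_left.mpr fun c h h' => by
      have := h3.2 (i + 1, c) (by simp [h]) (i, c) (by simp [h']) rfl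
      omega
    refine ⟨R₁ ∪ R₂, S, ?_, hS, ?_, ?_⟩
    · rw [Finset.card_union_of_disjoint hd1]
      omega
    · rw [Finset.union_inter_distrib_right, Finset.disjoint_iff_inter_eq_empty.mp hd2.symm,
        Finset.union_empty, ← hR₁]
      exact Finset.card_le_card Finset.inter_subset_left
    · ext ⟨a, b⟩
      simp only [Finset.mem_union, Finset.mem_product]
      tauto
  · rintro ⟨R, S, hR, hS, hRS, rfl⟩
    -- `T` holds the colors of the lower vertices that come before the upper ones.
    obtain ⟨T, hT1, hT2, hTc⟩ := Finset.exists_subsuperset_card_eq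
      (Finset.inter_subset_left : R ∩ S ⊆ R) hRS (hR ▸ hj)
    refine ⟨{i} ×ˢ T ∪ {i + 1} ×ˢ S, {i} ×ˢ (R \ T), isPattern_append.mpr
      ⟨_, _, isPattern_replicate.mpr ⟨T, hTc, rfl⟩, isPattern_replicate.mpr ⟨S, hS, rfl⟩, ?_,
        rfl⟩, isPattern_replicate.mpr ⟨R \ T, ?_, rfl⟩, ?_, ?_⟩
    · intro u hu v hv huv
      simp only [Finset.mem_product, Finset.mem_singleton] at hu hv
      omega
    · rw [Finset.card_sdiff_of_subset hT2, hR, hTc]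
    · rw [colorCompatible_union_left]
      constructor
      · intro u hu v hv huv
        simp only [Finset.mem_product, Finset.mem_singleton, Finset.mem_sdiff] at hu hv
        exact absurd (huv ▸ hu.2) hv.2.2
      · intro u hu v hv huv
        simp only [Finset.mem_product, Finset.mem_singleton, Finset.mem_sdiff] at hu hv
        exact absurd (hT1 (Finset.mem_inter.mpr ⟨hv.2.1, huv ▸ hu.2⟩)) hv.2.2
    · ext ⟨a, b⟩
      have := @hT2 b
      simp only [Finset.mem_union, Finset.mem_product, Finset.mem_sdiff]
      tauto

theorem isPattern_reduce {p : ListingPart} {E : Finset (ℕ × κ)} :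
    IsPattern p.reduce E ↔ IsPartPattern p E := by
  match p with
  | .vertex i => exact isPattern_singleton
  | .bicolored i r s H =>
    have hle := topMatch_le H
    rw [isPartPattern_bicolored, ListingPart.reduce]
    split_ifs with h
    · exact isPattern_listU (by omega)
    · exact isPattern_listD (by omega)

/-- Replacing the bicolored parts does not change the level-color patterns of proper colorings. -/
theorem isPattern_reduceListing {L : List ListingPart} {E : Finset (ℕ × κ)} :
    IsPattern (reduceListing L) E ↔ IsPattern L E := by
  induction L generalizing E with
  | nil => rfl
  | cons p L ih =>
    rw [isPattern_cons, reduceListing, List.flatMap_cons, isPattern_append]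
    simp only [isPattern_reduce]
    exact exists₂_congr fun E₁ E₂ => and_congr_right fun _ => and_congr_left fun _ => ih

end Pattern

theorem PartListingPoset.finite (L : List ListingPart) : Finite (PartListingPoset L) := by
  have : ∀ p : ListingPart, Finite p.Vert := by
    rintro (i | ⟨i, r, s, H⟩)
    · exact inferInstanceAs (Finite Unit)
    · exact inferInstanceAs (Finite (Fin r ⊕ Fin s))
  exact inferInstanceAs (Finite (Σ p : Fin L.length, (L.get p).Vert))

/-- The weight of a proper coloring can be read off from its level-color pattern, since vertices
on the same level have different colors. -/
theorem mem_colorWeights_iff_pattern {L : List ListingPart} {k : ℕ} {α : Fin k → ℕ} :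
    α ∈ colorWeights (incompGraph (PartListingPoset L)) k ↔
      ∃ E : Finset (ℕ × Fin k), IsPattern L E ∧ ∀ c, α c = (E.filter fun q => q.2 = c).card := by
  classical
  have := PartListingPoset.finite L
  have := Fintype.ofFinite (PartListingPoset L)
  have key : ∀ (f : (incompGraph (PartListingPoset L)).Coloring (Fin k)) (E : Finset (ℕ × Fin k)),
      (∀ q, q ∈ E ↔ ∃ x, (PartListingPoset.level x, f x) = q) →
      ∀ c, colorWeight f c = (E.filter fun q => q.2 = c).card := by
    intro f E hE c
    rw [colorWeight, Nat.card_eq_fintype_card, Fintype.card_subtype]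
    refine Finset.card_nbij (fun x => (PartListingPoset.level x, f x)) ?_ ?_ ?_
    · intro x hx
      exact Finset.mem_filter.mpr ⟨(hE _).mpr ⟨x, rfl⟩, by simpa using hx⟩
    · intro x _ y _ h
      obtain ⟨h1, h2⟩ := Prod.mk.inj h
      by_contra hne
      rcases lt_or_lt_of_not_incompGraph_adj hne (fun hadj => f.valid hadj h2) with h | h
      · have := PartListingPoset.Below.level_lt h
        omega
      · have := PartListingPoset.Below.level_lt h
        omega
    · intro q hq
      rw [Finset.mem_coe, Finset.mem_filter] at hq
      obtain ⟨x, rfl⟩ := (hE q).mp hq.1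
      exact ⟨x, by simpa using hq.2, rfl⟩
  constructor
  · rintro ⟨f, rfl⟩
    refine ⟨Finset.univ.image fun x => (PartListingPoset.level x, f x), ⟨f, by simp⟩,
      key f _ (by simp)⟩
  · rintro ⟨E, ⟨f, hf⟩, hα⟩
    exact ⟨f, funext fun c => (key f E hf c).trans (hα c).symm⟩

theorem colorWeights_reduceListing (L : List ListingPart) (k : ℕ) :
    colorWeights (incompGraph (PartListingPoset (reduceListing L))) k =
      colorWeights (incompGraph (PartListingPoset L)) k := by
  ext α
  simp only [mem_colorWeights_iff_pattern, isPattern_reduceListing]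

/-! ### Listings of single vertices and indifference graphs -/

/-- A finite poset in which `x < y` holds iff `y` lies more than `N` to the right of `x` on a line
has an indifference graph as its incomparability graph. -/
theorem exists_iso_hessenbergFun_graph {V : Type*} [Finite V] [PartialOrder V] (key : V → ℕ)
    (hkey : Function.Injective key) (N : ℕ) (hlt : ∀ x y, x < y ↔ key x + N < key y) :
    ∃ (n : ℕ) (h : HessenbergFun n), Nonempty (incompGraph V ≃g h.graph) := by
  classical
  have := Fintype.ofFinite V
  let s : Finset ℕ := Finset.univ.image key
  let e : Fin s.card ≃o s := s.orderIsoOfFin rfl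
  let e' : V ≃ s := Equiv.ofBijective (fun v => ⟨key v, Finset.mem_image_of_mem _ (Finset.mem_univ v)⟩)
    ⟨fun x y h => hkey (congrArg Subtype.val h), fun ⟨c, hc⟩ => by
      obtain ⟨v, -, rfl⟩ := Finset.mem_image.mp hc
      exact ⟨v, rfl⟩⟩
  let g : Fin s.card ≃ V := e.toEquiv.trans e'.symm
  have hg : ∀ i, key (g i) = e i := fun i => congrArg Subtype.val (e'.apply_symm_apply (e i))
  have hmono : StrictMono fun i => key (g i) := by
    intro i j hij
    simp only [hg]
    exact e.strictMono hij
  let T : Fin s.card → Finset (Fin s.card) := fun i =>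
    Finset.univ.filter fun j => key (g j) ≤ key (g i) + N
  have hT : ∀ i, i ∈ T i := fun i => by simp [T]
  let h : HessenbergFun s.card :=
    { toFun := fun i => (T i).max' ⟨i, hT i⟩
      le_toFun := fun i => Finset.le_max' _ _ (hT i)
      mono := fun i j hij => Finset.max'_subset _ fun l hl => by
        simp only [T, Finset.mem_filter, Finset.mem_univ, true_and] at hl ⊢
        exact hl.trans (Nat.add_le_add_right (hmono.monotone hij) N) }
  have hh : ∀ i j, j ≤ h.toFun i ↔ key (g j) ≤ key (g i) + N := by
    intro i j
    constructor
    · intro hj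
      have h1 : h.toFun i ∈ T i := Finset.max'_mem _ ⟨i, hT i⟩
      simp only [T, Finset.mem_filter, Finset.mem_univ, true_and] at h1
      exact (hmono.monotone hj).trans h1
    · intro hj
      exact Finset.le_max' _ _ (by simpa [T] using hj)
  refine ⟨s.card, h, ⟨RelIso.symm ⟨g, ?_⟩⟩⟩
  intro i j
  change (¬ g i ≤ g j ∧ ¬ g j ≤ g i) ↔ (i < j ∧ j ≤ h.toFun i) ∨ (j < i ∧ i ≤ h.toFun j)
  rw [hh, hh, le_iff_lt_or_eq, le_iff_lt_or_eq, hlt, hlt, g.injective.eq_iff, g.injective.eq_iff]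
  rcases lt_trichotomy i j with hij | rfl | hij
  · have := hmono hij
    simp only [hij, hij.ne, hij.ne', hij.not_gt] at this ⊢
    simp only [true_and, false_and, or_false]
    omega
  · simp
  · have := hmono hij
    simp only [hij, hij.ne, hij.ne', hij.not_gt] at this ⊢
    simp only [true_and, false_and, or_false, false_or]
    omega

theorem exists_vertex_of_mem_reduceListing {L : List ListingPart} {p : ListingPart}
    (hp : p ∈ reduceListing L) : ∃ i, p = .vertex i := by
  obtain ⟨q, -, hq⟩ := List.mem_flatMap.mp hp
  match q with
  | .vertex i => exact ⟨i, List.mem_singleton.mp hq⟩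
  | .bicolored i r s H =>
    rw [ListingPart.reduce] at hq
    split_ifs at hq
    · rw [listU] at hq
      simp only [List.mem_append, List.mem_replicate] at hq
      rcases hq with (⟨-, h⟩ | ⟨-, h⟩) | ⟨-, h⟩ <;> exact ⟨_, h⟩
    · rw [listD] at hq
      simp only [List.mem_append, List.mem_replicate] at hq
      rcases hq with (⟨-, h⟩ | ⟨-, h⟩) | ⟨-, h⟩ <;> exact ⟨_, h⟩

/-- The poset of a listing of `N` single vertices is a unit interval order: a vertex on level `i` at
position `p` is placed at the point `i * N + p`. -/
theorem exists_iso_hessenbergFun_graph_of_vertices {L : List ListingPart}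
    (hL : ∀ p ∈ L, ∃ i, p = .vertex i) :
    ∃ (n : ℕ) (h : HessenbergFun n), Nonempty (incompGraph (PartListingPoset L) ≃g h.graph) := by
  have := PartListingPoset.finite L
  have hext : ∀ x y : PartListingPoset L, x.1 = y.1 → x = y := by
    rintro ⟨i, a⟩ ⟨j, b⟩ h
    obtain rfl : i = j := h
    have hsub : ∀ p : ListingPart, (∃ l, p = .vertex l) → ∀ a b : p.Vert, a = b := by
      rintro _ ⟨l, rfl⟩ a b
      rfl
    rw [hsub _ (hL _ (List.get_mem L i)) a b]
  have hmul : ∀ a b : ℕ, a + 1 ≤ b → a * L.length + L.length ≤ b * L.length := fun a b h => by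
    rw [← Nat.succ_mul]
    exact Nat.mul_le_mul_right _ h
  refine exists_iso_hessenbergFun_graph
    (fun x : PartListingPoset L => PartListingPoset.level x * L.length + x.1.val) ?_ L.length ?_
  · intro x y h
    simp only at h
    have hx := x.1.isLt
    have hy := y.1.isLt
    refine hext x y (Fin.ext ?_)
    rcases lt_trichotomy (PartListingPoset.level x) (PartListingPoset.level y) with h1 | h1 | h1
    · have := hmul _ _ h1
      omega
    · rw [h1] at h
      omega
    · have := hmul _ _ h1
      omega
  · intro x y
    have hx := x.1.isLt
    have hy := y.1.isLt
    by_cases hxy : x.1 = y.1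
    · rw [hext x y hxy]
      simp
    · rw [PartListingPoset.lt_iff_of_ne hxy, Fin.lt_def]
      rcases lt_or_ge (PartListingPoset.level y) (PartListingPoset.level x + 1) with h1 | h1
      · have := Nat.mul_le_mul_right L.length (Nat.lt_succ_iff.mp h1)
        omega
      · rcases h1.eq_or_lt with h1 | h1
        · rw [← h1, Nat.succ_mul]
          omega
        · have := hmul _ _ h1
          rw [Nat.succ_mul] at this
          omega

/-! ### Part listings of `(3+1)`-free posets -/

/-- `x` and `y` are related by a path of `n` steps of `R`. -/
def StepPath {α : Type*} (R : α → α → Prop) : ℕ → α → α → Prop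
  | 0, x, y => x = y
  | n + 1, x, y => ∃ z, R x z ∧ StepPath R n z y

namespace StepPath

variable {α : Type*} {R : α → α → Prop}

theorem trans {m n : ℕ} {x y z : α} (h : StepPath R m x y) (h' : StepPath R n y z) :
    StepPath R (m + n) x z := by
  induction m generalizing x with
  | zero =>
    obtain rfl : x = y := h
    rwa [Nat.zero_add]
  | succ m ih =>
    obtain ⟨w, hw, h⟩ := h
    rw [Nat.succ_add]
    exact ⟨w, hw, ih h⟩

theorem single {x y : α} (h : R x y) : StepPath R 1 x y := ⟨y, h, rfl⟩

theorem exists_last {n : ℕ} {x y : α} (h : StepPath R (n + 1) x y) :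
    ∃ z, StepPath R n x z ∧ R z y := by
  induction n generalizing x with
  | zero =>
    obtain ⟨z, hz, rfl⟩ := h
    exact ⟨x, rfl, hz⟩
  | succ n ih =>
    obtain ⟨w, hw, h⟩ := h
    obtain ⟨z, hz, hzy⟩ := ih h
    exact ⟨z, ⟨w, hw, hz⟩, hzy⟩

theorem exists_of_reflTransGen {x y : α} (h : Relation.ReflTransGen R x y) :
    ∃ n, StepPath R n x y := by
  induction h with
  | refl => exact ⟨0, rfl⟩
  | tail _ h ih =>
    obtain ⟨n, hn⟩ := ih
    exact ⟨n + 1, hn.trans (single h)⟩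

/-- If the steps change the level by `1`, a path that climbs by at least two levels has two
consecutive steps upwards. -/
theorem exists_two_steps_up {lev : α → ℕ}
    (hR : ∀ x y, R x y → lev y = lev x + 1 ∨ lev x = lev y + 1) {m : ℕ} :
    ∀ {x y : α}, StepPath R m x y → lev x + 2 ≤ lev y →
      ∃ p q a b c, R a b ∧ R b c ∧ lev b = lev a + 1 ∧ lev c = lev b + 1 ∧ StepPath R p x a ∧
        StepPath R q c y ∧ p + 2 + q = m := by
  induction m using Nat.strong_induction_on with
  | _ m ih =>
  intro x y h hxy
  rcases m with _ | m
  · obtain rfl : x = y := h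
    omega
  obtain ⟨z, hxz, hzy⟩ := h
  by_cases hz : lev z + 2 ≤ lev y
  · obtain ⟨p, q, a, b, c, h1, h2, h3, h4, h5, h6, h7⟩ := ih m (by omega) hzy hz
    exact ⟨p + 1, q, a, b, c, h1, h2, h3, h4, ⟨z, hxz, h5⟩, h6, by omega⟩
  · have h1 := hR x z hxz
    rcases m with _ | m
    · obtain rfl : z = y := hzy
      omega
    obtain ⟨w, hzw, hwy⟩ := hzy
    rcases hR z w hzw with h2 | h2
    · exact ⟨0, m, x, z, w, hxz, hzw, by omega, h2, rfl, hwy, by omega⟩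
    · obtain ⟨p, q, a, b, c, h1, h2, h3, h4, h5, h6, h7⟩ := ih m (by omega) hwy (by omega)
      exact ⟨p + 2, q, a, b, c, h1, h2, h3, h4, ⟨z, hxz, w, hzw, h5⟩, h6, by omega⟩

end StepPath

/-- A total ordering of the strongly connected components of `R`, refining reachability. -/
theorem exists_component_position {α : Type*} [Finite α] (R : α → α → Prop) :
    ∃ pos : α → ℕ, (∀ x y, R x y → pos x ≤ pos y) ∧
      ∀ x y, pos x = pos y → Relation.ReflTransGen R x y ∧ Relation.ReflTransGen R y x := by
  classical
  let _ : Preorder α :=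
    { le := Relation.ReflTransGen R
      le_refl := fun _ => Relation.ReflTransGen.refl
      le_trans := fun _ _ _ => Relation.ReflTransGen.trans }
  let β := LinearExtension (Antisymmetrization α (· ≤ ·))
  have : Finite β := inferInstanceAs (Finite (Quotient _))
  have := Fintype.ofFinite β
  let e : Fin (Fintype.card β) ≃o β := Fintype.orderIsoFinOfCardEq β rfl
  let t : α → β := fun x => toLinearExtension (toAntisymmetrization (· ≤ ·) x)
  refine ⟨fun x => (e.symm (t x)).val, fun x y h => ?_, fun x y h => ?_⟩
  · exact e.symm.monotone (toLinearExtension.monotone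
      (toAntisymmetrization_le_toAntisymmetrization_iff.mpr (Relation.ReflTransGen.single h)))
  · have h1 : t x = t y := e.symm.injective (Fin.ext h)
    exact Quotient.exact (s := AntisymmRel.setoid α (· ≤ ·)) h1

/-- On a finite poset, the length of the longest chain below an element. -/
theorem exists_rank (P : Type*) [Finite P] [PartialOrder P] :
    ∃ lev : P → ℕ, (∀ x y, x < y → lev x < lev y) ∧ ∀ y n, n < lev y → ∃ x < y, lev x = n := by
  have := Fintype.ofFinite P
  have hfin : ∀ x : P, Order.height x < ⊤ := fun x =>
    (Order.height_le fun p _ => Nat.cast_le.mpr p.length_lt_card.le).trans_lt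
      (ENat.natCast_lt_top (Fintype.card P))
  have hcoe : ∀ x : P, ((Order.height x).toNat : ℕ∞) = Order.height x := fun x =>
    ENat.natCast_toNat (hfin x).ne
  refine ⟨fun x => (Order.height x).toNat, fun x y h => ?_, fun y n h => ?_⟩
  · have := Order.height_strictMono h (hfin x)
    rw [← hcoe x, ← hcoe y] at this
    exact_mod_cast this
  · have h1 : (n : ℕ∞) < Order.height y := by
      rw [← hcoe y]
      exact_mod_cast h
    obtain ⟨x, hx, hxn⟩ := (Order.coe_lt_height_iff (hfin y)).mp h1
    exact ⟨x, hx, by simp [hxn]⟩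

section Precedes

variable {P : Type*} [PartialOrder P] {lev : P → ℕ}

/-- The constraints for a part listing with given levels: for `x`, `y` on adjacent levels, `x` must
not come later than `y` if `x` is the lower one and `x < y`, or `x` is the upper one and the two are
incomparable. -/
def Precedes (lev : P → ℕ) (x y : P) : Prop :=
  (lev y = lev x + 1 ∧ x < y) ∨ (lev x = lev y + 1 ∧ ¬ y < x)

theorem Precedes.lev_eq {x y : P} (h : Precedes lev x y) :
    lev y = lev x + 1 ∨ lev x = lev y + 1 :=
  h.imp And.left And.left

theorem Precedes.lt {x y : P} (h : Precedes lev x y) (hl : lev y = lev x + 1) : x < y := by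
  rcases h with h | h
  · exact h.2
  · omega

theorem Precedes.not_lt {x y : P} (h : Precedes lev x y) (hl : lev x = lev y + 1) : ¬ y < x := by
  rcases h with h | h
  · omega
  · exact h.2

theorem precedes_or_precedes {x y : P} (hl : lev y = lev x + 1) :
    Precedes lev x y ∨ Precedes lev y x := by
  by_cases h : x < y
  · exact Or.inl (Or.inl ⟨hl, h⟩)
  · exact Or.inr (Or.inr ⟨hl, h⟩)

/-- The `(3+1)`-free condition on three consecutive levels forbids a cycle of length four that goes
two levels up and then two levels down. -/
theorem ChainSumFree.not_cycle (hP : ChainSumFree P 3 1) {a b c d : P}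
    (hab : Precedes lev a b) (hbc : Precedes lev b c) (hcd : Precedes lev c d)
    (hda : Precedes lev d a) (hb : lev b = lev a + 1) (hc : lev c = lev b + 1)
    (hd : lev d = lev b) : False := by
  rcases hP.le_or_le (hab.lt hb) (hbc.lt hc) d with h | h
  · refine hda.not_lt (by omega) (lt_of_le_of_ne h ?_)
    rintro rfl
    omega
  · refine hcd.not_lt (by omega) (lt_of_le_of_ne h ?_)
    rintro rfl
    omega

/-- Two consecutive steps upwards do not lie on a closed walk of constraints. In a shortest closed
walk with two such steps `a → b → c`, chosen as high as possible, the walk goes down from `c` to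
some `d`, and `a → d` since the `(3+1)`-free condition excludes `d → a`. Each way in which the walk
can continue then gives a shorter closed walk with two consecutive steps upwards. -/
theorem ChainSumFree.not_two_steps_up [Finite P] (hP : ChainSumFree P 3 1) {n : ℕ} {a b c : P} (hab : Precedes lev a b)
    (hbc : Precedes lev b c) (hb : lev b = lev a + 1) (hc : lev c = lev b + 1) :
    ¬ StepPath (Precedes lev) n c a := by
  obtain ⟨K, hK⟩ : ∃ K, ∀ x, lev x ≤ K := by
    obtain ⟨K, hK⟩ := (Set.finite_range lev).bddAbove
    exact ⟨K, fun x => hK ⟨x, rfl⟩⟩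
  induction n using Nat.strong_induction_on generalizing a b c with
  | _ n ihn =>
  induction hd : K - lev c using Nat.strong_induction_on generalizing a b c with
  | _ D ihD =>
  intro hca
  rcases n with _ | n
  · obtain rfl : c = a := hca
    omega
  obtain ⟨d, hcd, hda⟩ := hca
  rcases hcd.lev_eq with h1 | h1
  · -- The walk goes on upwards: use `b → c → d` instead of `a → b → c`.
    have h2 := hK d
    exact ihD (K - lev d) (by omega) hbc hcd hc h1 rfl (hda.trans (StepPath.single hab))
  have had : Precedes lev a d := (precedes_or_precedes (by omega)).resolve_right fun h =>
    hP.not_cycle hab hbc hcd h hb hc (by omega)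
  rcases n with _ | n
  · obtain rfl : d = a := hda
    omega
  obtain ⟨e, hde, hea⟩ := hda
  rcases hde.lev_eq with h2 | h2
  · exact ihn n (by omega) had hde (by omega) h2 hea
  rcases n with _ | n
  · obtain rfl : e = a := hea
    exact hP.not_cycle hab hbc hcd hde hb hc (by omega)
  obtain ⟨u, heu, hua⟩ := hea.exists_last
  rcases hua.lev_eq with h3 | h3
  · -- The walk reaches `a` from below: `u → a → d` are two steps upwards.
    exact ihn (n + 1) (by omega) hua had h3 (by omega) ⟨e, hde, heu⟩
  · -- The walk reaches `a` from above: `b` and `a` can be left out, by `u → c`.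
    have huc : Precedes lev u c := (precedes_or_precedes (by omega)).resolve_right fun h =>
      hP.not_cycle hab hbc h hua hb hc (by omega)
    obtain ⟨p, q, a', b', c', h4, h5, h6, h7, h8, h9, h10⟩ :=
      (heu.trans (StepPath.single huc)).exists_two_steps_up (fun _ _ => Precedes.lev_eq) (by omega)
    exact ihn (q + (1 + (1 + p))) (by omega) h4 h5 h6 h7
      (h9.trans ((StepPath.single hcd).trans ((StepPath.single hde).trans h8)))

theorem ChainSumFree.lev_le_of_reflTransGen [Finite P] (hP : ChainSumFree P 3 1) {x y : P}
    (hxy : Relation.ReflTransGen (Precedes lev) x y)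
    (hyx : Relation.ReflTransGen (Precedes lev) y x) : lev y ≤ lev x + 1 := by
  by_contra! hcon
  obtain ⟨m, hm⟩ := StepPath.exists_of_reflTransGen hxy
  obtain ⟨n, hn⟩ := StepPath.exists_of_reflTransGen hyx
  obtain ⟨p, q, a, b, c, h1, h2, h3, h4, h5, h6, -⟩ :=
    hm.exists_two_steps_up (fun _ _ => Precedes.lev_eq) (by omega)
  exact hP.not_two_steps_up h1 h2 h3 h4 (h6.trans (hn.trans h5))

theorem ChainSumFree.lt_of_two_le (hP : ChainSumFree P 3 1) (hlev : ∀ x y, x < y → lev x < lev y)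
    (hrank : ∀ y n, n < lev y → ∃ x < y, lev x = n) {x y : P} (h : lev x + 2 ≤ lev y) : x < y := by
  obtain ⟨y₁, hy₁, h1⟩ := hrank y (lev y - 1) (by omega)
  obtain ⟨y₀, hy₀, h0⟩ := hrank y₁ (lev y - 2) (by omega)
  rcases hP.le_or_le hy₀ hy₁ x with h2 | h2
  · rcases h2.eq_or_lt with rfl | h2
    · exact hy₀.trans hy₁
    · have := hlev _ _ h2
      omega
  · refine lt_of_le_of_ne h2 ?_
    rintro rfl
    omega

end Precedes

/-- Elements with levels and positions for which the order is the one of a part listing form the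
poset of a part listing: the elements on each position form a bicolored part. -/
theorem exists_listing_of_lev_pos {P : Type*} [Finite P] [PartialOrder P] (lev pos : P → ℕ)
    (hlev : ∀ x y, x < y → lev x < lev y) (htwo : ∀ x y, lev x + 2 ≤ lev y → x < y)
    (hone : ∀ x y, lev y = lev x + 1 → pos x ≠ pos y → (x < y ↔ pos x < pos y))
    (hpart : ∀ x y, pos x = pos y → lev y ≤ lev x + 1) :
    ∃ L : List ListingPart, Nonempty (P ≃o PartListingPoset L) := by
  classical
  obtain ⟨N, hN⟩ : ∃ N, ∀ x, pos x < N := by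
    obtain ⟨N, hN⟩ := (Set.finite_range pos).bddAbove
    exact ⟨N + 1, fun x => Nat.lt_succ_of_le (hN ⟨x, rfl⟩)⟩
  have hbase : ∀ p : ℕ, ∃ i, ∀ x, pos x = p → lev x = i ∨ lev x = i + 1 := by
    intro p
    by_cases h : ∃ i x, pos x = p ∧ lev x = i
    · obtain ⟨x, hx, hxi⟩ := Nat.find_spec h
      refine ⟨Nat.find h, fun y hy => ?_⟩
      have h1 := Nat.find_min' h ⟨y, hy, rfl⟩
      have h2 := hpart x y (hx.trans hy.symm)
      omega
    · exact ⟨0, fun x hx => absurd ⟨lev x, x, hx, rfl⟩ h⟩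
  choose base hbase using hbase
  let el : ∀ p, {x : P // pos x = p ∧ lev x = base p} ≃ Fin _ := fun p => Finite.equivFin _
  let eu : ∀ p, {x : P // pos x = p ∧ lev x = base p + 1} ≃ Fin _ := fun p => Finite.equivFin _
  let part : ℕ → ListingPart := fun p => .bicolored (base p) _ _
    (Finset.univ.filter fun e => ((el p).symm e.1).1 < ((eu p).symm e.2).1)
  let L : List ListingPart := List.ofFn fun p : Fin N => part p
  have hψ : ∀ j : Fin L.length, ∃ ψ : (L.get j).Vert → P, Function.Injective ψ ∧
      (∀ x, pos x = j.val ↔ ∃ v, ψ v = x) ∧ (∀ v, lev (ψ v) = (L.get j).level v) ∧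
      ∀ v w, (L.get j).Joined v w ↔ ψ v < ψ w := by
    intro j
    have hj : L.get j = part j.val := by simp [L]
    rw [hj]
    generalize j.val = p
    refine ⟨fun v => (Sum.elim (fun a => ((el p).symm a).1) (fun b => ((eu p).symm b).1) :
      Fin _ ⊕ Fin _ → P) v, ?_, ?_, ?_, ?_⟩
    · rintro (a | a) (b | b) h
      · exact congrArg Sum.inl ((el p).symm.injective (Subtype.ext h))
      · have h1 := ((el p).symm a).2.2
        have h2 := ((eu p).symm b).2.2
        have h : ((el p).symm a).1 = ((eu p).symm b).1 := h
        rw [h] at h1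
        omega
      · have h1 := ((eu p).symm a).2.2
        have h2 := ((el p).symm b).2.2
        have h : ((eu p).symm a).1 = ((el p).symm b).1 := h
        rw [h] at h1
        omega
      · exact congrArg Sum.inr ((eu p).symm.injective (Subtype.ext h))
    · intro x
      constructor
      · intro hx
        rcases hbase p x hx with h | h
        · exact ⟨.inl (el p ⟨x, hx, h⟩), congrArg Subtype.val ((el p).symm_apply_apply _)⟩
        · exact ⟨.inr (eu p ⟨x, hx, h⟩), congrArg Subtype.val ((eu p).symm_apply_apply _)⟩
      · rintro ⟨a | a, rfl⟩
        · exact ((el p).symm a).2.1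
        · exact ((eu p).symm a).2.1
    · rintro (a | a)
      · exact ((el p).symm a).2.2
      · exact ((eu p).symm a).2.2
    · have hlow : ∀ a, lev ((el p).symm a).1 = base p := fun a => ((el p).symm a).2.2
      have hupp : ∀ a, lev ((eu p).symm a).1 = base p + 1 := fun a => ((eu p).symm a).2.2
      rintro (a | a) (b | b)
      · refine ⟨False.elim, fun h => ?_⟩
        have := hlev _ _ h
        have h1 := hlow a
        have h2 := hlow b
        simp only [Sum.elim_inl] at this
        omega
      · exact Finset.mem_filter.trans (and_iff_right (Finset.mem_univ _))
      · refine ⟨False.elim, fun h => ?_⟩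
        have := hlev _ _ h
        have h1 := hupp a
        have h2 := hlow b
        simp only [Sum.elim_inl, Sum.elim_inr] at this
        omega
      · refine ⟨False.elim, fun h => ?_⟩
        have := hlev _ _ h
        have h1 := hupp a
        have h2 := hupp b
        simp only [Sum.elim_inr] at this
        omega
  choose ψ hinj hpos hψlev hjoin using hψ
  let Ψ : PartListingPoset L → P := fun x => ψ x.1 x.2
  have hΨpos : ∀ x, pos (Ψ x) = x.1.val := fun x => (hpos x.1 _).mpr ⟨x.2, rfl⟩
  have hΨlev : ∀ x, lev (Ψ x) = PartListingPoset.level x := fun x => hψlev x.1 x.2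
  have hΨ : Function.Bijective Ψ := by
    constructor
    · intro x y h
      have hxy : x.1 = y.1 :=
        Fin.ext ((hΨpos x).symm.trans ((congrArg pos h).trans (hΨpos y)))
      rcases x with ⟨i, a⟩
      rcases y with ⟨j, b⟩
      obtain rfl : i = j := hxy
      exact congrArg (Sigma.mk i) (hinj i h)
    · intro x
      obtain ⟨v, hv⟩ := (hpos ⟨pos x, by simp [L, hN]⟩ x).mp rfl
      exact ⟨⟨_, v⟩, hv⟩
  have hlt : ∀ x y, Ψ x < Ψ y ↔ x < y := by
    intro x y
    by_cases hxy : x.1 = y.1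
    · rcases x with ⟨i, a⟩
      rcases y with ⟨j, b⟩
      obtain rfl : i = j := hxy
      exact (hjoin i a b).symm.trans PartListingPoset.below_mk_mk_iff.symm
    · have hne : pos (Ψ x) ≠ pos (Ψ y) := by
        rw [hΨpos, hΨpos]
        exact fun h => hxy (Fin.ext h)
      rw [PartListingPoset.lt_iff_of_ne hxy, ← hΨlev, ← hΨlev, Fin.lt_def, ← hΨpos, ← hΨpos]
      constructor
      · intro h
        rcases (Nat.succ_le_of_lt (hlev _ _ h)).eq_or_lt with h1 | h1
        · exact Or.inr ⟨h1, (hone _ _ h1.symm hne).mp h⟩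
        · exact Or.inl h1
      · rintro (h | ⟨h1, h2⟩)
        · exact htwo _ _ h
        · exact (hone _ _ h1.symm hne).mpr h2
  refine ⟨L, ⟨OrderIso.symm ⟨Equiv.ofBijective Ψ hΨ, fun {x y} => ?_⟩⟩⟩
  change Ψ x ≤ Ψ y ↔ x ≤ y
  rw [le_iff_lt_or_eq, le_iff_lt_or_eq, hlt, hΨ.1.eq_iff]

/-- Every finite `(3+1)`-free poset has a part listing: take the rank as the level, and order the
strongly connected components of the constraints. -/
theorem ChainSumFree.exists_listing {P : Type*} [Finite P] [PartialOrder P]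
    (hP : ChainSumFree P 3 1) : ∃ L : List ListingPart, Nonempty (P ≃o PartListingPoset L) := by
  obtain ⟨lev, hlev, hrank⟩ := exists_rank P
  obtain ⟨pos, hmono, hcomp⟩ := exists_component_position (Precedes lev)
  refine exists_listing_of_lev_pos lev pos hlev (fun x y => hP.lt_of_two_le hlev hrank) ?_ ?_
  · intro x y hl hne
    constructor
    · exact fun h => lt_of_le_of_ne (hmono x y (Or.inl ⟨hl, h⟩)) hne
    · intro h
      by_contra hcon
      have := hmono y x (Or.inr ⟨hl, hcon⟩)
      omega
  · intro x y h
    exact hP.lev_le_of_reflTransGen (hcomp x y h).1 (hcomp x y h).2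

/-! ### Greatest weights -/

/-- `lam` is the greatest element of the family `W` of sets of compositions in dominance order: all
its parts are positive, it dominates all elements of `W`, and it belongs to `W`, in any number
`k ≥ ℓ(lam)` of entries. -/
structure IsGreatestWeight (W : (k : ℕ) → Set (Fin k → ℕ)) (lam : List ℕ) : Prop where
  pos : ∀ a ∈ lam, 0 < a
  dominates : ∀ k, ∀ α ∈ W k, Dominates lam α
  mem : ∀ k, lam.length ≤ k → (fun i : Fin k => lam.getD i 0) ∈ W k

theorem partialSum_getD (lam : List ℕ) {k : ℕ} (hk : lam.length ≤ k) (m : ℕ) :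
    partialSum (fun i : Fin k => lam.getD i 0) m = (lam.take m).sum := by
  induction m with
  | zero => simp [partialSum_zero]
  | succ m ih =>
    rw [List.sum_take_add_one, ← ih]
    by_cases hm : m < k
    · exact partialSum_succ (fun i : Fin k => lam.getD i 0) ⟨m, hm⟩
    · rw [partialSum_of_le _ (by omega), partialSum_of_le _ (by omega),
        List.getD_eq_default _ _ (by omega), add_zero]

namespace IsGreatestWeight

variable {W : (k : ℕ) → Set (Fin k → ℕ)} {lam mu : List ℕ}

theorem sum_take_le (h : IsGreatestWeight W lam) (h' : IsGreatestWeight W mu) (m : ℕ) :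
    (lam.take m).sum ≤ (mu.take m).sum := by
  have h1 := h.mem (max lam.length mu.length) (le_max_left _ _)
  have h2 := (h'.dominates _ _ h1).2 m
  have h3 := partialSum_getD lam (le_max_left lam.length mu.length) m
  rw [partialSum] at h3
  rwa [h3] at h2

theorem unique (h : IsGreatestWeight W lam) (h' : IsGreatestWeight W mu) : lam = mu := by
  have hsum : ∀ m, (lam.take m).sum = (mu.take m).sum := fun m =>
    (h.sum_take_le h' m).antisymm (h'.sum_take_le h m)
  have hget : ∀ m, lam.getD m 0 = mu.getD m 0 := by
    intro m
    have h1 := hsum (m + 1)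
    rw [List.sum_take_add_one, List.sum_take_add_one, hsum m] at h1
    omega
  have hlen : ∀ {l l' : List ℕ}, (∀ a ∈ l', 0 < a) → (∀ m, l.getD m 0 = l'.getD m 0) →
      l'.length ≤ l.length := by
    intro l l' hpos heq
    by_contra! hlt
    have h1 := heq l.length
    rw [List.getD_eq_default _ _ le_rfl, List.getD_eq_getElem _ _ hlt] at h1
    have := hpos _ (List.getElem_mem hlt)
    omega
  refine List.ext_getElem (le_antisymm (hlen h.pos fun m => (hget m).symm) (hlen h'.pos hget)) ?_
  intro m h1 h2
  rw [← List.getD_eq_getElem _ 0 h1, ← List.getD_eq_getElem _ 0 h2, hget]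

theorem isPartition (h : IsGreatestWeight W lam)
    (hW : ∀ k, ∀ α ∈ W k, ∀ σ : Equiv.Perm (Fin k), α ∘ σ ∈ W k) : IsPartition lam := by
  refine ⟨List.sortedGE_iff_pairwise.mpr (List.pairwise_iff_getElem.mpr fun i j hi hj hij => ?_),
    h.pos⟩
  have h1 := hW _ _ (h.mem _ le_rfl) (Equiv.swap ⟨i, hi⟩ ⟨j, hj⟩)
  have h2 : partialSum _ (i + 1) ≤ _ := (h.dominates _ _ h1).2 (i + 1)
  have h3 := partialSum_succ ((fun l : Fin lam.length => lam.getD l 0) ∘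
    Equiv.swap ⟨i, hi⟩ ⟨j, hj⟩) ⟨i, hi⟩
  have h4 : partialSum ((fun l : Fin lam.length => lam.getD l 0) ∘
      Equiv.swap ⟨i, hi⟩ ⟨j, hj⟩) i = partialSum (fun l : Fin lam.length => lam.getD l 0) i := by
    refine Finset.sum_congr rfl fun l hl => ?_
    simp only [Finset.mem_filter, Finset.mem_univ, true_and] at hl
    rw [Function.comp_apply, Equiv.swap_apply_of_ne_of_ne]
    · rintro rfl
      exact lt_irrefl _ hl
    · rintro rfl
      exact lt_asymm hl hij
  rw [partialSum_getD _ le_rfl] at h4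
  rw [h3, h4, List.sum_take_add_one, Function.comp_apply, Equiv.swap_apply_left] at h2
  rw [List.getD_eq_getElem _ _ hi, List.getD_eq_getElem _ _ hj] at h2
  omega

/-- Compositions with fewer than `ℓ(lam)` entries are too short to be dominated by `lam`. -/
theorem eq_empty (h : IsGreatestWeight W lam) {k : ℕ} (hk : k < lam.length) : W k = ∅ := by
  refine Set.eq_empty_of_forall_notMem fun α hα => ?_
  obtain ⟨h1, h2⟩ := h.dominates k α hα
  have h2 : partialSum α k ≤ _ := h2 k
  rw [partialSum_of_le _ le_rfl, h1] at h2
  have h3 : (lam.take k).sum + (lam.drop k).sum = lam.sum := by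
    rw [← List.sum_append, List.take_append_drop]
  have h4 : (lam.drop k).sum = 0 := by omega
  have h5 : lam[k] ∈ lam.drop k := List.mem_drop_iff_getElem.mpr ⟨0, by omega, by simp⟩
  have h6 := List.single_le_sum (fun _ _ => Nat.zero_le _) _ h5
  have h7 := h.pos _ (List.getElem_mem hk)
  omega

end IsGreatestWeight

/-- The greedy weight of an indifference graph is the greatest weight of its proper colorings. -/
theorem isGreatestWeight_greedyWeight {n : ℕ} (h : HessenbergFun n) :
    IsGreatestWeight (colorWeights h.graph) (greedyWeight h.graph) where
  pos := greedyWeight_pos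
  dominates := by
    rintro k _ ⟨f, rfl⟩
    exact dominates_greedyWeight h f
  mem := fun k hk => by
    refine ⟨SimpleGraph.Coloring.mk
      (fun v => ⟨greedyColor h.graph v, (greedyColor_lt_length v).trans_le hk⟩)
      fun {u v} hadj heq => greedyColor_ne_of_adj hadj (congrArg Fin.val heq), funext fun i => ?_⟩
    rw [greedyWeight_getD]
    exact Nat.card_congr ((Equiv.refl _).subtypeEquiv fun v => Fin.ext_iff)

/-- Any composition all of whose rearrangements are dominated by an element of `S` lies in `S`, if
`S` is closed under permutations and unit transfers. -/
theorem mem_of_partialSum_perm_le {k : ℕ} {S : Set (Fin k → ℕ)}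
    (hperm : ∀ a ∈ S, ∀ σ : Equiv.Perm (Fin k), a ∘ σ ∈ S)
    (hS : ∀ a ∈ S, ∀ a' i j, IsTransfer a a' i j → a' ∈ S) {a b : Fin k → ℕ} (ha : a ∈ S)
    (hsum : ∑ i, a i = ∑ i, b i)
    (hle : ∀ (σ : Equiv.Perm (Fin k)) (m : ℕ), partialSum (b ∘ σ) m ≤ partialSum a m) : b ∈ S := by
  let σ := Tuple.sort fun i => OrderDual.toDual (b i)
  have hσ : Antitone (b ∘ σ) := Tuple.monotone_sort fun i => OrderDual.toDual (b i)
  have h1 : b ∘ σ ∈ S := mem_of_partialSum_le hS hσ ha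
    (hsum.trans (Equiv.sum_comp σ b).symm) (hle σ)
  have h2 := hperm _ h1 σ.symm
  rwa [Function.comp_assoc, Equiv.self_comp_symm, Function.comp_id] at h2

/-! ### The Newton polytope -/

theorem mem_support_chromaticSymm {V : Type*} [Fintype V] {G : SimpleGraph V} {k : ℕ}
    {m : Fin k →₀ ℕ} : m ∈ (chromaticSymm G k).support ↔ ⇑m ∈ colorWeights G k := by
  classical
  have h1 : ∀ f : G.Coloring (Fin k), (∏ v : V, MvPolynomial.X (f v) : MvPolynomial (Fin k) ℝ) =
      MvPolynomial.monomial (∑ v, Finsupp.single (f v) 1) 1 := by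
    intro f
    rw [MvPolynomial.monomial_sum_one]
    rfl
  have h2 : ∀ f : G.Coloring (Fin k), ⇑(∑ v, Finsupp.single (f v) 1 : Fin k →₀ ℕ) =
      colorWeight f := by
    intro f
    funext i
    rw [Finsupp.finsetSum_apply, colorWeight, Nat.card_eq_fintype_card, Fintype.card_subtype,
      Finset.card_filter]
    exact Finset.sum_congr rfl fun v _ => Finsupp.single_apply
  rw [MvPolynomial.mem_support_iff, chromaticSymm, MvPolynomial.coeff_sum]
  simp only [h1, MvPolynomial.coeff_monomial]
  rw [Finset.sum_boole, Nat.cast_ne_zero, Finset.card_ne_zero]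
  constructor
  · rintro ⟨f, hf⟩
    exact ⟨f, by rw [← h2, (Finset.mem_filter.mp hf).2]⟩
  · rintro ⟨f, hf⟩
    exact ⟨f, Finset.mem_filter.mpr ⟨Finset.mem_univ f, DFunLike.coe_injective ((h2 f).trans hf)⟩⟩

theorem mem_supportPoints_chromaticSymm {V : Type*} [Fintype V] {G : SimpleGraph V} {k : ℕ}
    {x : Fin k → ℝ} :
    x ∈ supportPoints (chromaticSymm G k) ↔ ∃ α ∈ colorWeights G k, ∀ i, x i = (α i : ℝ) := by
  constructor
  · rintro ⟨m, hm, hx⟩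
    exact ⟨m, mem_support_chromaticSymm.mp hm, hx⟩
  · rintro ⟨α, hα, hx⟩
    refine ⟨Finsupp.equivFunOnFinite.symm α, mem_support_chromaticSymm.mpr hα, hx⟩

theorem comp_perm_mem_convexHull {k : ℕ} {T : Set (Fin k → ℝ)} {σ : Equiv.Perm (Fin k)}
    (hT : ∀ x ∈ T, x ∘ σ ∈ T) {x : Fin k → ℝ} (hx : x ∈ convexHull ℝ T) :
    x ∘ σ ∈ convexHull ℝ T := by
  have h1 : LinearMap.funLeft ℝ ℝ σ x ∈ LinearMap.funLeft ℝ ℝ σ '' convexHull ℝ T :=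
    Set.mem_image_of_mem _ hx
  rw [LinearMap.image_convexHull] at h1
  refine convexHull_mono ?_ h1
  rintro _ ⟨y, hy, rfl⟩
  exact hT y hy

/-- A unit transfer from entry `i` to entry `j` is a convex combination of the identity and the
transposition of the two entries. -/
theorem IsTransfer.mem_of_convex {k : ℕ} {a a' : Fin k → ℕ} {i j : Fin k}
    (h : IsTransfer a a' i j) {C : Set (Fin k → ℝ)} (hC : Convex ℝ C)
    (h1 : (fun l => (a l : ℝ)) ∈ C) (h2 : (fun l => (a (Equiv.swap i j l) : ℝ)) ∈ C) :
    (fun l => (a' l : ℝ)) ∈ C := by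
  have hij := h.ne
  have hd : (2 : ℝ) ≤ a i - a j := by
    have : ((a j + 2 : ℕ) : ℝ) ≤ a i := Nat.cast_le.mpr h.two_le
    push_cast at this
    linarith
  set d : ℝ := a i - a j with hdef
  have hd0 : d ≠ 0 := by linarith
  have hs : ((a' i : ℕ) : ℝ) = a i - 1 := by
    rw [← h.source]
    push_cast
    ring
  have ht : ((a' j : ℕ) : ℝ) = a j + 1 := by
    rw [h.target]
    push_cast
    ring
  -- The weight `1 / d` of the transposition moves `d * (1 / d) = 1` unit.
  have hmem := hC h1 h2 (a := 1 - 1 / d) (b := 1 / d)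
    (by
      rw [sub_nonneg, div_le_one (by linarith)]
      linarith) (by positivity) (by ring)
  convert hmem using 1
  funext l
  simp only [Pi.add_apply, Pi.smul_apply, smul_eq_mul]
  by_cases hi : l = i
  · subst hi
    rw [Equiv.swap_apply_left, hs]
    have : (a j : ℝ) = a l - d := by rw [hdef]; ring
    rw [this]
    field_simp
    ring
  · by_cases hj : l = j
    · subst hj
      rw [Equiv.swap_apply_right, ht]
      have : (a i : ℝ) = a l + d := by rw [hdef]; ring
      rw [this]
      field_simp
      ring
    · rw [Equiv.swap_apply_of_ne_of_ne hi hj, h.other l hi hj]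
      ring

/-- If the weights of the proper colorings of `G` are closed under unit transfers and have a
greatest element `lam`, then they are the lattice points of the permutahedron of `lam`. -/
theorem isSNP_and_newtonPolytope_eq {V : Type*} [Fintype V] {G : SimpleGraph V} {lam : List ℕ}
    (hlam : IsGreatestWeight (colorWeights G) lam) {k : ℕ}
    (hW : ∀ a ∈ colorWeights G k, ∀ a' i j, IsTransfer a a' i j → a' ∈ colorWeights G k) :
    IsSNP (chromaticSymm G k) ∧ newtonPolytope (chromaticSymm G k) = permutahedron lam k := by
  by_cases hk : lam.length ≤ k
  swap
  · have h1 : supportPoints (chromaticSymm G k) = ∅ := by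
      refine Set.eq_empty_of_forall_notMem fun x hx => ?_
      obtain ⟨α, hα, -⟩ := mem_supportPoints_chromaticSymm.mp hx
      rw [hlam.eq_empty (not_le.mp hk)] at hα
      exact hα
    simp [IsSNP, newtonPolytope, permutahedron, h1, hk]
  set T : Set (Fin k → ℝ) :=
    {x | ∃ σ : Equiv.Perm (Fin k), ∀ i, x i = (lam.getD (σ i) 0 : ℝ)} with hT
  have hmem := hlam.mem k hk
  have hdom : ∀ α ∈ colorWeights G k, ∑ i, α i = lam.sum ∧
      ∀ (σ : Equiv.Perm (Fin k)) (m : ℕ), partialSum (α ∘ σ) m ≤ (lam.take m).sum := fun α hα =>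
    ⟨(hlam.dominates k α hα).1, fun σ => (hlam.dominates k _ (colorWeights_comp_perm hα σ)).2⟩
  constructor
  · refine Set.Subset.antisymm ?_ ?_
    · intro x hx
      refine ⟨subset_convexHull ℝ _ hx, ?_⟩
      obtain ⟨α, -, hα⟩ := mem_supportPoints_chromaticSymm.mp hx
      exact ⟨fun i => α i, fun i => by simp [hα i]⟩
    · rintro x ⟨hx, z, hz⟩
      -- The linear inequalities that express dominance hold on the whole Newton polytope.
      let C : Set (Fin k → ℝ) := {y | (∀ i, 0 ≤ y i) ∧ ∑ i, y i = lam.sum ∧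
        ∀ (σ : Equiv.Perm (Fin k)) (m : ℕ), ∑ i with i.val < m, y (σ i) ≤ (lam.take m).sum}
      have hC : Convex ℝ C := by
        rintro y ⟨h1, h2, h3⟩ w ⟨h4, h5, h6⟩ s t hs ht hst
        refine ⟨fun i => ?_, ?_, fun σ m => ?_⟩
        · exact add_nonneg (mul_nonneg hs (h1 i)) (mul_nonneg ht (h4 i))
        · simp only [Pi.add_apply, Pi.smul_apply, smul_eq_mul, Finset.sum_add_distrib,
            ← Finset.mul_sum, h2, h5]
          rw [← add_mul, hst, one_mul]
        · simp only [Pi.add_apply, Pi.smul_apply, smul_eq_mul, Finset.sum_add_distrib,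
            ← Finset.mul_sum]
          calc _ ≤ s * ((lam.take m).sum : ℝ) + t * ((lam.take m).sum : ℝ) :=
                add_le_add (mul_le_mul_of_nonneg_left (h3 σ m) hs)
                  (mul_le_mul_of_nonneg_left (h6 σ m) ht)
            _ = _ := by rw [← add_mul, hst, one_mul]
      have hsub : supportPoints (chromaticSymm G k) ⊆ C := by
        intro y hy
        obtain ⟨α, hα, hyα⟩ := mem_supportPoints_chromaticSymm.mp hy
        obtain ⟨h1, h2⟩ := hdom α hα
        refine ⟨fun i => ?_, ?_, fun σ m => ?_⟩
        · rw [hyα]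
          exact Nat.cast_nonneg _
        · simp only [hyα]
          rw [← h1]
          push_cast
          rfl
        · simp only [hyα]
          have := h2 σ m
          rw [partialSum] at this
          simp only [Function.comp_apply] at this
          exact_mod_cast this
      obtain ⟨h1, h2, h3⟩ := convexHull_min hsub hC hx
      have hb : ∀ i, x i = ((z i).toNat : ℝ) := by
        intro i
        have h4 : 0 ≤ z i := by
          have := h1 i
          rw [hz] at this
          exact_mod_cast this
        rw [hz]
        exact_mod_cast (Int.toNat_of_nonneg h4).symm
      refine mem_supportPoints_chromaticSymm.mpr ⟨fun i => (z i).toNat, ?_, hb⟩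
      refine mem_of_partialSum_perm_le (fun a ha σ => colorWeights_comp_perm ha σ) hW hmem ?_ ?_
      · rw [(hdom _ hmem).1]
        simp only [hb] at h2
        exact_mod_cast h2.symm
      · intro σ m
        rw [partialSum_getD lam hk]
        have := h3 σ m
        simp only [hb] at this
        exact_mod_cast this
  · rw [newtonPolytope, permutahedron, if_pos hk]
    refine Set.Subset.antisymm (convexHull_min ?_ (convex_convexHull ℝ _)) (convexHull_mono ?_)
    · intro x hx
      obtain ⟨α, hα, hxα⟩ := mem_supportPoints_chromaticSymm.mp hx
      obtain rfl : x = fun i => (α i : ℝ) := funext hxα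
      -- The permutahedron is closed under permutations and unit transfers.
      let S : Set (Fin k → ℕ) := {b | (fun i => (b i : ℝ)) ∈ convexHull ℝ T}
      have hperm : ∀ b ∈ S, ∀ σ : Equiv.Perm (Fin k), b ∘ σ ∈ S := by
        intro b hb σ
        refine comp_perm_mem_convexHull (σ := σ) ?_ hb
        rintro y ⟨τ, hτ⟩
        exact ⟨σ.trans τ, fun i => hτ (σ i)⟩
      refine mem_of_partialSum_perm_le (S := S) (a := fun i : Fin k => lam.getD i 0) hperm ?_ ?_ ?_
        ?_
      · intro a ha a' i j h
        exact h.mem_of_convex (convex_convexHull ℝ T) ha (hperm a ha (Equiv.swap i j))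
      · exact subset_convexHull ℝ T ⟨Equiv.refl _, fun i => rfl⟩
      · rw [(hdom _ hmem).1, (hdom _ hα).1]
      · intro σ m
        rw [partialSum_getD lam hk]
        exact (hdom α hα).2 σ m
    · rintro x ⟨σ, hσ⟩
      exact mem_supportPoints_chromaticSymm.mpr ⟨_, colorWeights_comp_perm hmem σ, hσ⟩

/-- An order isomorphism is an isomorphism of incomparability graphs. -/
def OrderIso.incompGraphIso {P Q : Type*} [PartialOrder P] [PartialOrder Q] (e : P ≃o Q) :
    incompGraph P ≃g incompGraph Q where
  toEquiv := e.toEquiv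
  map_rel_iff' {x y} := by
    change (¬ e x ≤ e y ∧ ¬ e y ≤ e x) ↔ (¬ x ≤ y ∧ ¬ y ≤ x)
    rw [e.le_iff_le, e.le_iff_le]

theorem isGreatestWeight_of_isGreedyWeight {P : Type*} [PartialOrder P] {L : List ListingPart}
    (e : P ≃o PartListingPoset L) {mu : List ℕ} (hmu : IsGreedyWeight L mu) :
    IsGreatestWeight (colorWeights (incompGraph P)) mu := by
  obtain ⟨n, h, ⟨φ⟩, rfl⟩ := hmu
  have hW : colorWeights (incompGraph P) = colorWeights h.graph := by
    funext k
    rw [colorWeights_congr e.incompGraphIso, ← colorWeights_reduceListing, colorWeights_congr φ]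
  rw [hW]
  exact isGreatestWeight_greedyWeight h

theorem exists_isGreedyWeight (L : List ListingPart) : ∃ mu, IsGreedyWeight L mu := by
  obtain ⟨n, h, φ⟩ := exists_iso_hessenbergFun_graph_of_vertices
    fun p hp => exists_vertex_of_mem_reduceListing (L := L) hp
  exact ⟨_, n, h, φ, rfl⟩

theorem theorem5p5 {P : Type*} [Fintype P] [PartialOrder P] (hP : ChainSumFree P 3 1) :
    ∃ lam : List ℕ,
      IsPartition lam ∧
      (∃ L : List ListingPart, Nonempty (P ≃o PartListingPoset L)) ∧
      (∀ L : List ListingPart, Nonempty (P ≃o PartListingPoset L) →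
        ∀ mu : List ℕ, IsGreedyWeight L mu ↔ mu = lam) ∧
      (∀ k : ℕ,
        IsSNP (chromaticSymm (incompGraph P) k) ∧
        newtonPolytope (chromaticSymm (incompGraph P) k) = permutahedron lam k) ∧
      (∀ (k : ℕ) (f : (incompGraph P).Coloring (Fin k)), Dominates lam (colorWeight f)) := by
  obtain ⟨L₀, ⟨e₀⟩⟩ := hP.exists_listing
  obtain ⟨lam, hlam₀⟩ := exists_isGreedyWeight L₀
  have hlam := isGreatestWeight_of_isGreedyWeight e₀ hlam₀
  refine ⟨lam, hlam.isPartition fun k α hα σ => colorWeights_comp_perm hα σ, ⟨L₀, ⟨e₀⟩⟩, ?_, ?_, ?_⟩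
  · rintro L ⟨e⟩ mu
    constructor
    · exact fun h => (isGreatestWeight_of_isGreedyWeight e h).unique hlam
    · rintro rfl
      obtain ⟨mu', h⟩ := exists_isGreedyWeight L
      rwa [hlam.unique (isGreatestWeight_of_isGreedyWeight e h)]
  · exact fun k => isSNP_and_newtonPolytope_eq hlam fun a ha a' i j h =>
      hP.colorWeights_transfer ha h
  · exact fun k f => hlam.dominates k _ ⟨f, rfl⟩
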